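/- Let $\mathbb F$ be a field of characteristic zero and $\mathfrak k$ a differential graded Lie algebra over $\mathbb F$ concentrated in degrees $-1$ and $-2$ (differential $d$ of degree $-1$), with a contraction $(\nabla,\pi,h)$ onto its homology: chain maps $\nabla\colon \mathrm H(\mathfrak k)\to\mathfrak k$, $\pi\colon\mathfrak k\to \mathrm H(\mathfrak k)$ with $\pi\nabla=\mathrm{Id}$ and a degree $1$ operator $h$ with $dh+hd=\mathrm{Id}-\nabla\pi$, $hh=0$, $h\nabla=0$, $\pi h=0$. Let $V=s\mathfrak k$ (degrees $0,-1$) and $\mathbf v=s\mathrm H(\mathfrak k)$ be the suspensions, with the induced contraction ($d$ and $h$ change sign under $s$). For a vector space $U$ let $\mathrm S^{\mathrm c}[U]$ be the symmetric (cofree cocomplete coaugmented cocommutative) coalgebra with cogenerating map $\mathrm S^{\mathrm c}[U]\to U$, and let $\mathrm S^{\mathrm c}[V]=\mathrm S^{\mathrm c}[V_0]\otimes\Lambda^{\mathrm c}[V_{-1}]$, $\mathrm S^{\mathrm c}[\mathbf v]=\mathrm S^{\mathrm c}[\mathbf v_0]\otimes\Lambda^{\mathrm c}[\mathbf v_{-1}]$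 be the graded symmetric coalgebras. Let $q\colon V_0\to V_{-1}$, $q(x)=\tfrac12[x,x]$ (suspensions suppressed), let $Q\colon \mathrm S^{\mathrm c}[V_0]\to V_{-1}$ be the corresponding linear map, supported on the second symmetric copower, and let $q_B=dh\,q$, $Q_B=dh\,Q$ be the components in $dV_0$. Let $\partial$, $\partial_B$ be the coderivations of $\mathrm S^{\mathrm c}[V]$ determined by $Q$, $Q_B$, so that $(\mathrm S^{\mathrm c}[V],d+\partial)$ is the classifying coalgebra of $\mathfrak k$. Let $J=d+q\colon V_0\to V_{-1}$, let $\mathcal V_{\mathfrak k}=J^{-1}(0)\subseteq V_0$ be the variety defined by the equation $J(x)=0$, and let $\mathcal M_{\mathfrak k}\subseteq V_0$ be the variety, containing the origin, defined by $x_2+h(q_B(x))=0$, where $x_2=hd(x)$. For a polynomial map $f\colon V_0\to W$ with associated linear map $y\colon \mathrm S^{\mathrm c}[V_0]\to W$, the coordinate coalgebra of the variety defined by the equation $f=0$ is the kernel of $(\mathrm{Id}\otimes y)\Delta\colon \mathrm S^{\mathrm c}[V_0]\to \mathrm S^{\mathrm c}[V_0]\otimes W$ (i.e. the variety carries the ideal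 generated by its defining equations); this defines the subcoalgebras $C[\mathcal M_{\mathfrak k}]$ and $C[\mathcal V_{\mathfrak k}]$ of $\mathrm S^{\mathrm c}[V_0]$. Let $\tau=\tau^1+\tau^2+\cdots\colon \mathrm S^{\mathrm c}[\mathbf v]\to\mathfrak k$ be given by $\tau^1=\nabla\circ s^{-1}$ on the cogenerators and $\tau^\ell=\tfrac12 h([\tau^1,\tau^{\ell-1}]+\dots+[\tau^{\ell-1},\tau^1])$ for $\ell\ge2$, and let $\mathcal D=\mathcal D^1+\mathcal D^2+\cdots$, where $\mathcal D^{\ell-1}$ is the coderivation of $\mathrm S^{\mathrm c}[\mathbf v]$ determined by $\tfrac12\pi([\tau^1,\tau^{\ell-1}]+\dots+[\tau^{\ell-1},\tau^1])$. Let $C_{\mathfrak k}=\mathrm H_0(\mathrm S^{\mathrm c}_{\mathcal D}[\mathbf v])\subseteq \mathrm S^{\mathrm c}[\mathbf v_0]$ be the Kuranishi coalgebra. Then, as subcoalgebras of $\mathrm S^{\mathrm c}[V_0]$, $\mathrm H_0(\mathrm S^{\mathrm c}_{d+\partial_B}[V])=C[\mathcal M_{\mathfrak k}]$, $\mathrm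 H_0(\mathrm S^{\mathrm c}_{d+\partial}[V])=C[\mathcal V_{\mathfrak k}]$, and $C[\mathcal V_{\mathfrak k}]\subseteq C[\mathcal M_{\mathfrak k}]$. There is a unique morphism of coaugmented coalgebras $\overline\tau\colon \mathrm S^{\mathrm c}[\mathbf v_0]\to \mathrm S^{\mathrm c}[V_0]$ (the degree zero constituent of the adjoint of $\tau$) whose composite with the cogenerating map $\mathrm S^{\mathrm c}[V_0]\to V_0$ is $s\tau|_{\mathrm S^{\mathrm c}[\mathbf v_0]}$. Its values lie in $C[\mathcal M_{\mathfrak k}]$, and $$\overline\tau\colon \mathrm S^{\mathrm c}[\mathbf v_0]\to C[\mathcal M_{\mathfrak k}],\qquad \mathrm S^{\mathrm c}[\pi]|_{C[\mathcal M_{\mathfrak k}]}\colon C[\mathcal M_{\mathfrak k}]\to \mathrm S^{\mathrm c}[\mathbf v_0]$$ are mutually inverse isomorphisms of coalgebras; that is, $\overline\tau$ is the formal inverse of the projection from $\mathcal M_{\mathfrak k}$ to its tangent space $\mathbf v_0$ at the origin. Furthermore, $\overline\tau$ restricts to an isomorphism of coalgebras from $C_{\mathfrak k}$ onto $C[\mathcal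 V_{\mathfrak k}]$. -/

import Mathlib

open scoped TensorProduct

namespace FormalKuranishi

/-! ### Subcoalgebras -/

section Subcoalgebra

theorem map_subtype_injective {F : Type*} [Field F] {C : Type*} [AddCommGroup C] [Module F C]
    (D : Submodule F C) : Function.Injective (TensorProduct.map D.subtype D.subtype) :=
  TensorProduct.map_injective_of_flat_flat _ _ D.subtype_injective D.subtype_injective

variable (F : Type*) [Field F] (C : Type*) [AddCommGroup C] [Module F C] [Coalgebra F C]

/-- A subcoalgebra of a coalgebra `C` over a field: a subspace `D` with `Δ(D) ⊆ D ⊗ D`. -/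
structure Subcoalgebra extends Submodule F C where
  comul_mem : ∀ x ∈ toSubmodule, Coalgebra.comul (R := F) x ∈
    LinearMap.range (TensorProduct.map toSubmodule.subtype toSubmodule.subtype)

variable {F C}

namespace Subcoalgebra

/-- The comultiplication that a subcoalgebra inherits. -/
noncomputable def comulMap (D : Subcoalgebra F C) :
    D.toSubmodule →ₗ[F] D.toSubmodule ⊗[F] D.toSubmodule :=
  (LinearEquiv.ofInjective _ (map_subtype_injective D.toSubmodule)).symm.toLinearMap ∘ₗ
    (Coalgebra.comul ∘ₗ D.toSubmodule.subtype).codRestrict _ (fun x => D.comul_mem x x.2)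

theorem map_comulMap (D : Subcoalgebra F C) (x : D.toSubmodule) :
    TensorProduct.map D.toSubmodule.subtype D.toSubmodule.subtype (D.comulMap x) =
      Coalgebra.comul (R := F) (x : C) := by
  have h := LinearEquiv.apply_symm_apply
    (LinearEquiv.ofInjective _ (map_subtype_injective D.toSubmodule))
    (((Coalgebra.comul (R := F) ∘ₗ D.toSubmodule.subtype).codRestrict _
      (fun x => D.comul_mem x x.2)) x)
  exact congrArg Subtype.val h

/-- A subcoalgebra is a coalgebra, with the structure that makes the inclusion a coalgebra map. -/
noncomputable instance instCoalgebra (D : Subcoalgebra F C) : Coalgebra F D.toSubmodule where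
  comul := D.comulMap
  counit := Coalgebra.counit ∘ₗ D.toSubmodule.subtype
  coassoc := by
    set i := D.toSubmodule.subtype
    have hi := D.toSubmodule.subtype_injective
    have hc : TensorProduct.map i i ∘ₗ D.comulMap = Coalgebra.comul ∘ₗ i :=
      LinearMap.ext D.map_comulMap
    have hinj : Function.Injective (TensorProduct.map i (TensorProduct.map i i)) :=
      TensorProduct.map_injective_of_flat_flat _ _ hi (map_subtype_injective _)
    have e : TensorProduct.map i (TensorProduct.map i i) ∘ₗ
        (TensorProduct.assoc F D.toSubmodule D.toSubmodule D.toSubmodule).toLinearMap =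
        (TensorProduct.assoc F C C C).toLinearMap ∘ₗ
          TensorProduct.map (TensorProduct.map i i) i := by
      ext; simp
    rw [← LinearMap.cancel_left hinj]
    calc TensorProduct.map i (TensorProduct.map i i) ∘ₗ
          (TensorProduct.assoc F D.toSubmodule D.toSubmodule D.toSubmodule).toLinearMap ∘ₗ
          D.comulMap.rTensor _ ∘ₗ D.comulMap
        = (TensorProduct.assoc F C C C).toLinearMap ∘ₗ
          (TensorProduct.map (TensorProduct.map i i) i ∘ₗ D.comulMap.rTensor _) ∘ₗ
            D.comulMap := by
          rw [← LinearMap.comp_assoc, e]; rfl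
      _ = (TensorProduct.assoc F C C C).toLinearMap ∘ₗ
          (Coalgebra.comul.rTensor C ∘ₗ TensorProduct.map i i) ∘ₗ D.comulMap := by
          rw [LinearMap.map_comp_rTensor, hc, LinearMap.rTensor_comp_map]
      _ = Coalgebra.comul.lTensor C ∘ₗ Coalgebra.comul ∘ₗ i := by
          rw [LinearMap.comp_assoc, hc]
          exact congrArg (fun z => z ∘ₗ i) (Coalgebra.coassoc (R := F) (A := C))
      _ = (TensorProduct.map i (TensorProduct.map i i) ∘ₗ D.comulMap.lTensor _) ∘ₗ
            D.comulMap := by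
          rw [LinearMap.map_comp_lTensor, hc, ← hc, ← LinearMap.comp_assoc,
            LinearMap.lTensor_comp_map, hc]
      _ = _ := rfl
  rTensor_counit_comp_comul := by
    set i := D.toSubmodule.subtype
    have hi := D.toSubmodule.subtype_injective
    have hc : TensorProduct.map i i ∘ₗ D.comulMap = Coalgebra.comul ∘ₗ i :=
      LinearMap.ext D.map_comulMap
    have hinj : Function.Injective (i.lTensor F) :=
      Module.Flat.lTensor_preserves_injective_linearMap _ hi
    rw [← LinearMap.cancel_left hinj, ← LinearMap.comp_assoc, LinearMap.lTensor_comp_rTensor,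
      ← LinearMap.rTensor_comp_map, LinearMap.comp_assoc, hc, ← LinearMap.comp_assoc,
      Coalgebra.rTensor_counit_comp_comul]
    rfl
  lTensor_counit_comp_comul := by
    set i := D.toSubmodule.subtype
    have hi := D.toSubmodule.subtype_injective
    have hc : TensorProduct.map i i ∘ₗ D.comulMap = Coalgebra.comul ∘ₗ i :=
      LinearMap.ext D.map_comulMap
    have hinj : Function.Injective (i.rTensor F) :=
      Module.Flat.rTensor_preserves_injective_linearMap _ hi
    rw [← LinearMap.cancel_left hinj, ← LinearMap.comp_assoc, LinearMap.rTensor_comp_lTensor,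
      ← LinearMap.lTensor_comp_map, LinearMap.comp_assoc, hc, ← LinearMap.comp_assoc,
      Coalgebra.lTensor_counit_comp_comul]
    rfl

end Subcoalgebra

end Subcoalgebra

/-! ### The coordinate coalgebra of a zero locus -/

section ZeroLocus

variable {F : Type*} [Field F] {C : Type*} [AddCommGroup C] [Module F C] [Coalgebra F C]
variable {W : Type*} [AddCommGroup W] [Module F W]

/-- The morphism of `C`-comodules `(C ⊗ y) Δ : C → C ⊗ C → C ⊗ W` that a linear map `y : C → W`
induces. -/
noncomputable def comoduleMap (y : C →ₗ[F] W) : C →ₗ[F] C ⊗[F] W :=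
  y.lTensor C ∘ₗ Coalgebra.comul

/-- The kernel of the comodule map `(C ⊗ y) Δ : C → C ⊗ W`; since `C` is cocommutative, it is a
subcoalgebra.  When `C = Sᶜ[U]` and `y : Sᶜ[U] → W` is the formal map of a polynomial map
`f : U → W`, this is the coordinate coalgebra of the closed subvariety (subscheme) of the affine
space `U` that the equation `f = 0` defines: it consists of the members of `Sᶜ[U]` that are
annihilated by the ideal of `S[U*]` that the components of `f` generate. -/
noncomputable def zeroLocus [Coalgebra.IsCocomm F C] (y : C →ₗ[F] W) : Subcoalgebra F C where
  toSubmodule := LinearMap.ker (comoduleMap y)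
  comul_mem := by
    intro x hx
    set ψ := comoduleMap y with hψ
    set i := (LinearMap.ker ψ).subtype with hi
    have hii : Function.Injective i := Submodule.subtype_injective _
    have hex : Function.Exact i ψ := LinearMap.exact_subtype_ker_map ψ
    have h1 : ψ.lTensor C (Coalgebra.comul (R := F) x) = 0 := by
      have e : ψ.lTensor C ∘ₗ Coalgebra.comul =
          (TensorProduct.assoc F C C W).toLinearMap ∘ₗ (Coalgebra.comul.rTensor W) ∘ₗ ψ := by
        rw [hψ, comoduleMap, LinearMap.lTensor_comp, LinearMap.comp_assoc, ← Coalgebra.coassoc]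
        have e1 : (y.lTensor C).lTensor C ∘ₗ (TensorProduct.assoc F C C C).toLinearMap ∘ₗ
            (Coalgebra.comul (R := F)).rTensor C = (TensorProduct.assoc F C C W).toLinearMap ∘ₗ
              (Coalgebra.comul (R := F)).rTensor W ∘ₗ y.lTensor C := by
          rw [LinearMap.rTensor_comp_lTensor, ← LinearMap.lTensor_comp_rTensor,
            ← LinearMap.comp_assoc, ← LinearMap.comp_assoc]
          congr 1
          ext; simp
        rw [← LinearMap.comp_assoc, ← LinearMap.comp_assoc,
          LinearMap.comp_assoc _ _ (LinearMap.lTensor _ _), e1]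
        rfl
      have := congr($e x)
      simp only [LinearMap.comp_apply] at this
      rw [this, LinearMap.mem_ker.mp hx]; simp
    have h2 : ψ.rTensor C (Coalgebra.comul (R := F) x) = 0 := by
      rw [← Coalgebra.comm_comul F x]
      have : ψ.rTensor C (TensorProduct.comm F C C (Coalgebra.comul (R := F) x)) =
          TensorProduct.comm F C (C ⊗[F] W) (ψ.lTensor C (Coalgebra.comul (R := F) x)) := by
        have e : ψ.rTensor C ∘ₗ (TensorProduct.comm F C C).toLinearMap =
            (TensorProduct.comm F C (C ⊗[F] W)).toLinearMap ∘ₗ ψ.lTensor C := by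
          ext; simp
        exact congr($e (Coalgebra.comul (R := F) x))
      rw [this, h1, map_zero]
    obtain ⟨w, hw⟩ := (Module.Flat.lTensor_exact C hex _).mp h1
    have h3 : i.lTensor (C ⊗[F] W) (ψ.rTensor _ w) = 0 := by
      rw [← h2, ← hw, ← LinearMap.comp_apply, ← LinearMap.comp_apply,
        LinearMap.lTensor_comp_rTensor, LinearMap.rTensor_comp_lTensor]
    have h4 : ψ.rTensor _ w = 0 :=
      Module.Flat.lTensor_preserves_injective_linearMap _ hii (by rw [h3, map_zero])
    obtain ⟨v, hv⟩ := (Module.Flat.rTensor_exact _ hex _).mp h4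
    refine ⟨v, ?_⟩
    rw [← hw, ← hv, ← LinearMap.comp_apply, LinearMap.lTensor_comp_rTensor]

end ZeroLocus

/-! ### The symmetric coalgebra -/

section Sc

variable (F : Type*) [Field F]

/-- The symmetric coalgebra `Sᶜ[U]` cogenerated by a vector space `U`.  Over a field of
characteristic zero the canonical map from the symmetric algebra `S[U]` (with the members of `U`
primitive) to `Sᶜ[U]` is an isomorphism of Hopf algebras, and `Sᶜ[U]` is realized here as the
coalgebra that underlies the Hopf algebra `S[U]`; the divided power `γ_n(u)`, i.e. the symmetric
tensor `u ⊗ ⋯ ⊗ u`, is `(1 / n!) uⁿ`. -/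
abbrev Sc (U : Type*) [AddCommGroup U] [Module F U] : Type _ := SymmetricAlgebra F U

variable {F}
variable {U W : Type*} [AddCommGroup U] [Module F U] [AddCommGroup W] [Module F W]

/-- The cogenerating morphism `Sᶜ[U] → U`: the projection to the constituent of degree `1`. -/
noncomputable def cogen : Sc F U →ₗ[F] U := by
  letI : Module Fᵐᵒᵖ U := Module.compHom _ ((RingHom.id F).fromOpposite mul_comm)
  haveI : IsCentralScalar F U := ⟨fun _ _ => rfl⟩
  exact (TrivSqZeroExt.sndHom F U).comp
    (SymmetricAlgebra.lift (TrivSqZeroExt.inrHom F U)).toLinearMap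

theorem cogen_ι (u : U) : cogen (SymmetricAlgebra.ι F U u) = u := by
  simp [cogen]

theorem cogen_algebraMap (r : F) : cogen (algebraMap F (Sc F U) r) = 0 := by
  simp only [cogen]
  let : Module Fᵐᵒᵖ U := Module.compHom _ ((RingHom.id F).fromOpposite mul_comm)
  have : IsCentralScalar F U := ⟨fun _ _ => rfl⟩
  simp only [LinearMap.comp_apply, AlgHom.toLinearMap_apply, AlgHom.commutes]
  rfl

theorem cogen_mul (x y : Sc F U) : cogen (x * y) =
    (Coalgebra.counit (R := F) x) • cogen y + (Coalgebra.counit (R := F) y) • cogen x := by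
  let : Module Fᵐᵒᵖ U := Module.compHom _ ((RingHom.id F).fromOpposite mul_comm)
  have : IsCentralScalar F U := ⟨fun _ _ => rfl⟩
  have hc : ∀ z : Sc F U, (SymmetricAlgebra.lift (TrivSqZeroExt.inrHom F U) z).fst =
      Coalgebra.counit (R := F) z := by
    intro z
    have h : (TrivSqZeroExt.fstHom F F U).comp
        (SymmetricAlgebra.lift (TrivSqZeroExt.inrHom F U)) = Bialgebra.counitAlgHom F (Sc F U) := by
      ext; simp [SymmetricAlgebra.algebraMapInv_ι]
    exact congr($h z)
  have hs : ∀ z : Sc F U, cogen z = (SymmetricAlgebra.lift (TrivSqZeroExt.inrHom F U) z).snd :=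
    fun _ => rfl
  rw [hs, hs, hs, map_mul, TrivSqZeroExt.snd_mul, hc, hc]
  rfl

/-- The morphism of coalgebras (even of Hopf algebras) `Sᶜ[f] : Sᶜ[U] → Sᶜ[W]` that a linear map
`f` induces. -/
noncomputable def Sc.map (f : U →ₗ[F] W) : Sc F U →ₐc[F] Sc F W :=
  BialgHom.ofAlgHom (SymmetricAlgebra.lift (SymmetricAlgebra.ι F W ∘ₗ f))
    (by ext x; simp [SymmetricAlgebra.algebraMapInv_ι])
    (by ext x; simp)

/-- The coaugmentation filtration: `Fil n` is the sum of the symmetric copowers of degree at most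
`n`. -/
noncomputable def Fil (F : Type*) [Field F] (U : Type*) [AddCommGroup U] [Module F U] (n : ℕ) :
    Submodule F (Sc F U) :=
  (1 ⊔ LinearMap.range (SymmetricAlgebra.ι F U)) ^ n

theorem Fil_mono : Monotone (Fil F U) := pow_right_monotone le_sup_left

theorem exists_mem_Fil (x : Sc F U) : ∃ n, x ∈ Fil F U n := by
  induction x using SymmetricAlgebra.induction with
  | algebraMap r => exact ⟨0, by rw [Fil, pow_zero]; exact Submodule.mem_one.mpr ⟨r, rfl⟩⟩
  | ι u => exact ⟨1, by rw [Fil, pow_one]; exact Submodule.mem_sup_right ⟨u, rfl⟩⟩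
  | mul a b ha hb =>
    obtain ⟨m, hm⟩ := ha
    obtain ⟨n, hn⟩ := hb
    exact ⟨m + n, by rw [Fil, pow_add]; exact Submodule.mul_mem_mul hm hn⟩
  | add a b ha hb =>
    obtain ⟨m, hm⟩ := ha
    obtain ⟨n, hn⟩ := hb
    exact ⟨max m n, add_mem (Fil_mono (le_max_left m n) hm) (Fil_mono (le_max_right m n) hn)⟩

/-- `Σ_{i+j=n} Fil i ⊗ Fil j`. -/
noncomputable def FilT (F : Type*) [Field F] (U : Type*) [AddCommGroup U] [Module F U] (n : ℕ) :
    Submodule F (Sc F U ⊗[F] Sc F U) :=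
  Submodule.span F {t | ∃ i j, i + j = n ∧ ∃ a ∈ Fil F U i, ∃ b ∈ Fil F U j, a ⊗ₜ[F] b = t}

theorem FilT_mul {m n : ℕ} {s t : Sc F U ⊗[F] Sc F U} (hs : s ∈ FilT F U m)
    (ht : t ∈ FilT F U n) : s * t ∈ FilT F U (m + n) := by
  have h : FilT F U m * FilT F U n ≤ FilT F U (m + n) := by
    rw [FilT, FilT, Submodule.span_mul_span]
    refine Submodule.span_mono ?_
    rintro _ ⟨_, ⟨i, j, rfl, a, ha, b, hb, rfl⟩, _, ⟨k, l, rfl, c, hc, d, hd, rfl⟩, rfl⟩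
    refine ⟨i + k, j + l, by omega, a * c, ?_, b * d, ?_, ?_⟩
    · rw [Fil, pow_add]; exact Submodule.mul_mem_mul ha hc
    · rw [Fil, pow_add]; exact Submodule.mul_mem_mul hb hd
    · simp
  exact h (Submodule.mul_mem_mul hs ht)

theorem comul_mem_FilT {n : ℕ} {x : Sc F U} (hx : x ∈ Fil F U n) :
    Coalgebra.comul (R := F) x ∈ FilT F U n := by
  have one_mem : ∀ n, (1 : Sc F U) ∈ Fil F U n := fun n =>
    Fil_mono (Nat.zero_le n) (by rw [Fil, pow_zero]; exact Submodule.one_le.mp le_rfl)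
  have one_mem' : ∀ n, (1 : Sc F U ⊗[F] Sc F U) ∈ FilT F U n := fun n =>
    Submodule.subset_span ⟨0, n, by omega, 1, one_mem 0, 1, one_mem n, rfl⟩
  induction hx using Submodule.pow_induction_on_left' with
  | algebraMap r =>
    rw [Bialgebra.comul_algebraMap, Algebra.algebraMap_eq_smul_one]
    exact Submodule.smul_mem _ _ (one_mem' 0)
  | add x y i _ _ hx hy => rw [map_add]; exact add_mem hx hy
  | mem_mul m hm i x _ ih =>
    rw [Bialgebra.comul_mul, Nat.succ_eq_one_add]
    refine FilT_mul ?_ ih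
    obtain ⟨_, hr, _, ⟨u, rfl⟩, rfl⟩ := Submodule.mem_sup.mp hm
    obtain ⟨r, rfl⟩ := Submodule.mem_one.mp hr
    have hu : SymmetricAlgebra.ι F U u ∈ Fil F U 1 := by
      rw [Fil, pow_one]; exact Submodule.mem_sup_right ⟨u, rfl⟩
    rw [map_add, Bialgebra.comul_algebraMap, Algebra.algebraMap_eq_smul_one,
      SymmetricAlgebra.comul_ι]
    exact add_mem (Submodule.smul_mem _ _ (one_mem' 1)) (add_mem
      (Submodule.subset_span ⟨1, 0, rfl, _, hu, 1, one_mem 0, rfl⟩)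
      (Submodule.subset_span ⟨0, 1, rfl, 1, one_mem 0, _, hu, rfl⟩))

/-- The product on `Hom(C, V)` with values in `Hom(C, W)` that a bilinear map `B` induces:
`c ↦ Σ B(a(c₁), b(c₂))` in Sweedler notation.  (All that it is applied to here, the coalgebra and
its maps, sits in a single degree, and no Koszul sign occurs.) -/
noncomputable def cup {C V W : Type*} [AddCommGroup C] [Module F C] [Coalgebra F C]
    [AddCommGroup V] [Module F V] [AddCommGroup W] [Module F W]
    (B : V →ₗ[F] V →ₗ[F] W) (a b : C →ₗ[F] V) : C →ₗ[F] W :=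
  TensorProduct.lift B ∘ₗ TensorProduct.map a b ∘ₗ Coalgebra.comul

/-- `f` vanishes on the symmetric copowers of degree less than `n`. -/
def VanishBelow (n : ℕ) (f : Sc F U →ₗ[F] W) : Prop :=
  ∀ m < n, ∀ x ∈ Fil F U m, f x = 0

theorem VanishBelow.cup {V : Type*} [AddCommGroup V] [Module F V] (B : V →ₗ[F] V →ₗ[F] W)
    {k l : ℕ} {a b : Sc F U →ₗ[F] V} (ha : VanishBelow k a) (hb : VanishBelow l b) :
    VanishBelow (k + l) (cup B a b) := by
  intro m hm x hx
  have h : FilT F U m ≤ LinearMap.ker (TensorProduct.lift B ∘ₗ TensorProduct.map a b) := by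
    refine Submodule.span_le.mpr ?_
    rintro _ ⟨i, j, rfl, c, hc, d, hd, rfl⟩
    rcases lt_or_ge i k with h | h
    · simp [ha i h c hc]
    · simp [hb j (by omega) d hd]
  exact h (comul_mem_FilT hx)

/-- The (naively converging) sum of a sequence of linear maps of which, when applied to an element,
only finitely many terms are non-zero. -/
noncomputable def pointwiseSum {A B : Type*} [AddCommGroup A] [Module F A] [AddCommGroup B]
    [Module F B] (f : ℕ → A →ₗ[F] B) (hf : ∀ x, ∃ N, ∀ n ≥ N, f n x = 0) : A →ₗ[F] B where
  toFun x := ∑ᶠ n, f n x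
  map_add' x y := by
    have fin : ∀ x, (Function.support fun n => f n x).Finite := fun x => by
      obtain ⟨N, hN⟩ := hf x
      exact (Set.finite_lt_nat N).subset fun n hn => by
        by_contra h; exact hn (hN n (not_lt.mp h))
    simp only [map_add]
    exact finsum_add_distrib (fin x) (fin y)
  map_smul' r x := by
    simp only [map_smul, RingHom.id_apply]
    exact (smul_finsum r _).symm

theorem VanishBelow.locallyFinite {f : ℕ → Sc F U →ₗ[F] W} (hf : ∀ n, VanishBelow n (f n))
    (x : Sc F U) : ∃ N, ∀ n ≥ N, f n x = 0 := by
  obtain ⟨m, hm⟩ := exists_mem_Fil x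
  exact ⟨m + 1, fun n hn => hf n m (by omega) x hm⟩

/-- `φ` is the adjoint of `f : Sᶜ[X] → U`: the morphism of coaugmented coalgebras
`Sᶜ[X] → Sᶜ[U]` whose composite with the cogenerating morphism of `Sᶜ[U]` is `f`. -/
def IsAdjoint {X : Type*} [AddCommGroup X] [Module F X] (f : Sc F X →ₗ[F] U)
    (φ : Sc F X →ₗc[F] Sc F U) : Prop :=
  φ 1 = 1 ∧ ∀ x, cogen (φ x) = f x

/-- `y : Sᶜ[U] → W` is the formal map of the algebraic map `f : U → W`: it vanishes on almost all
symmetric copowers, and `f(u) = Σ_n y(γ_n(u))`. -/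
def IsFormalMapOf (y : Sc F U →ₗ[F] W) (f : U → W) : Prop :=
  ∃ N : ℕ, (∀ n ≥ N, ∀ u : U, y (SymmetricAlgebra.ι F U u ^ n) = 0) ∧
    ∀ u : U, f u = ∑ n ∈ Finset.range N, y ((n.factorial : F)⁻¹ • SymmetricAlgebra.ι F U u ^ n)

theorem counit_ι_pow (u : U) (n : ℕ) :
    Coalgebra.counit (R := F) (SymmetricAlgebra.ι F U u ^ n) = if n = 0 then 1 else 0 := by
  rw [Bialgebra.counit_pow, SymmetricAlgebra.counit_ι, zero_pow_eq]

theorem cogen_ι_pow (u : U) (n : ℕ) :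
    cogen (SymmetricAlgebra.ι F U u ^ n) = if n = 1 then u else 0 := by
  have h1 : cogen (1 : Sc F U) = 0 := by simpa using cogen_algebraMap (U := U) (1 : F)
  rcases n with _ | _ | n
  · simpa using h1
  · simpa using cogen_ι u
  · rw [pow_succ, cogen_mul, counit_ι_pow, SymmetricAlgebra.counit_ι]
    simp

theorem cup_cogen_ι_pow (B : U →ₗ[F] U →ₗ[F] W) (u : U) (n : ℕ) :
    cup B cogen cogen (SymmetricAlgebra.ι F U u ^ n) = if n = 2 then (2 : F) • B u u else 0 := by
  simp only [cup, LinearMap.comp_apply]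
  rw [Bialgebra.comul_pow, SymmetricAlgebra.comul_ι, add_pow, map_sum, map_sum]
  have : ∀ m ∈ Finset.range (n + 1), TensorProduct.lift B (TensorProduct.map cogen cogen
      ((SymmetricAlgebra.ι F U u ⊗ₜ[F] 1) ^ m * (1 ⊗ₜ[F] SymmetricAlgebra.ι F U u) ^ (n - m) *
        ((n.choose m : ℕ) : Sc F U ⊗[F] Sc F U))) =
      if m = 1 then (if n = 2 then (2 : F) • B u u else 0) else 0 := by
    intro m hm
    rw [mul_comm, ← nsmul_eq_mul, map_nsmul, map_nsmul, Algebra.TensorProduct.tmul_pow,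
      Algebra.TensorProduct.tmul_pow, one_pow, one_pow, Algebra.TensorProduct.tmul_mul_tmul,
      one_mul, mul_one, TensorProduct.map_tmul, TensorProduct.lift.tmul, cogen_ι_pow, cogen_ι_pow]
    by_cases h : m = 1
    · subst h
      by_cases h2 : n = 2
      · subst h2; simp [two_smul]
      · have h3 : n - 1 ≠ 1 := by rw [Finset.mem_range] at hm; omega
        simp [h2, h3]
    · simp [h]
  rw [Finset.sum_congr rfl this, Finset.sum_ite_eq']
  by_cases h2 : n = 2 <;> simp [h2]

end Sc

/-! ### The graded symmetric coalgebra of a graded vector space in degrees `0` and `-1` -/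

section GSc

variable {F : Type*} [Field F]
variable {U W : Type*} [AddCommGroup U] [Module F U] [AddCommGroup W] [Module F W]

/-- The graded symmetric coalgebra `Sᶜ[U ⊕ W] = Sᶜ[U] ⊗ Λᶜ[W]` on the graded vector space that is
`U` in degree `0` and `W` in degree `-1`; its constituent of degree `-j` is `Sᶜ[U] ⊗ Λʲ[W]`. -/
abbrev GSc (F U W : Type*) [Field F] [AddCommGroup U] [Module F U] [AddCommGroup W] [Module F W] :
    Type _ := Sc F U ⊗[F] ExteriorAlgebra F W

open CliffordAlgebra GradedTensorProduct in
/-- The diagonal of the exterior algebra, as a morphism of algebras into the graded tensor product;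
it sends `w` to `w ⊗ 1 + 1 ⊗ w`. -/
noncomputable def comulExtAlg : ExteriorAlgebra F W →ₐ[F]
    evenOdd (0 : QuadraticForm F W) ᵍ⊗[F] evenOdd (0 : QuadraticForm F W) :=
  (ofProd (0 : QuadraticForm F W) (0 : QuadraticForm F W)).comp
    (CliffordAlgebra.map (Q₁ := (0 : QuadraticForm F W)) (Q₂ := (0 : QuadraticForm F W).prod 0)
      ⟨LinearMap.id.prod LinearMap.id, fun w => by simp⟩)

open CliffordAlgebra GradedTensorProduct in
theorem comulExtAlg_ι (w : W) : comulExtAlg (ExteriorAlgebra.ι F w) =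
    ExteriorAlgebra.ι F w ᵍ⊗ₜ[F] 1 + 1 ᵍ⊗ₜ[F] ExteriorAlgebra.ι F w := by
  exact (congrArg (ofProd (0 : QuadraticForm F W) 0)
    (CliffordAlgebra.map_apply_ι (Q₁ := (0 : QuadraticForm F W)) _ w)).trans (ofProd_ι_mk _ _ w w)

open CliffordAlgebra GradedTensorProduct in
/-- The diagonal of the exterior coalgebra `Λᶜ[W]`. -/
noncomputable def comulExt :
    ExteriorAlgebra F W →ₗ[F] ExteriorAlgebra F W ⊗[F] ExteriorAlgebra F W :=
  (of F (evenOdd (0 : QuadraticForm F W)) (evenOdd (0 : QuadraticForm F W))).symm.toLinearMap ∘ₗ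
    comulExtAlg.toLinearMap

/-- Left multiplication by `w`. -/
noncomputable def mulL (w : W) : ExteriorAlgebra F W →ₗ[F] ExteriorAlgebra F W :=
  LinearMap.mulLeft F (ExteriorAlgebra.ι F w)

/-- The grading involution of the exterior algebra: `(-1)^j` in degree `j`. -/
noncomputable def invol : ExteriorAlgebra F W →ₗ[F] ExteriorAlgebra F W :=
  (CliffordAlgebra.involute (Q := (0 : QuadraticForm F W))).toLinearMap

open CliffordAlgebra GradedTensorProduct in
theorem comulExt_ι_mul (w : W) (l : ExteriorAlgebra F W) :
    comulExt (ExteriorAlgebra.ι F w * l) =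
      (mulL w).rTensor _ (comulExt l) + TensorProduct.map invol (mulL w) (comulExt l) := by
  have key : ∀ z : evenOdd (0 : QuadraticForm F W) ᵍ⊗[F] evenOdd (0 : QuadraticForm F W),
      (of F _ _).symm ((ExteriorAlgebra.ι F w ᵍ⊗ₜ[F] 1 + 1 ᵍ⊗ₜ[F] ExteriorAlgebra.ι F w) * z) =
        (mulL w).rTensor _ ((of F _ _).symm z) +
          TensorProduct.map invol (mulL w) ((of F _ _).symm z) := by
    intro z
    have e : ∃ z', of F (evenOdd (0 : QuadraticForm F W)) (evenOdd (0 : QuadraticForm F W)) z' = z :=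
      ⟨_, symm_of_of _ _ z⟩
    obtain ⟨z', rfl⟩ := e
    induction z' using TensorProduct.induction_on with
    | zero => simp
    | add x y hx hy => simp only [map_add, mul_add] at *; rw [hx, hy]; abel
    | tmul a b =>
      induction a using DirectSum.Decomposition.inductionOn (evenOdd (0 : QuadraticForm F W)) with
      | zero => simp
      | add x y hx hy => simp only [map_add, mul_add, TensorProduct.add_tmul] at *; rw [hx, hy]; abel
      | @homogeneous i a =>
        rw [add_mul, map_add]
        congr 1
        · erw [tmul_one_mul_coe_tmul]
          rfl
        · have hw : ExteriorAlgebra.ι F w ∈ evenOdd (0 : QuadraticForm F W) 1 :=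
            ι_mem_evenOdd_one _ w
          erw [tmul_coe_mul_coe_tmul (evenOdd (0 : QuadraticForm F W))
            (evenOdd (0 : QuadraticForm F W)) 1 ⟨_, hw⟩ a b]
          have hi : ∀ j : ZMod 2, j = 0 ∨ j = 1 := by decide
          obtain ⟨a, ha⟩ := a
          rcases hi i with rfl | rfl
          · have h : invol a = a := involute_eq_of_mem_even ha
            rw [of_symm_of, TensorProduct.map_tmul, h, mul_zero, uzpow_zero, one_smul, one_mul]
            rfl
          · have h : invol a = -a := involute_eq_of_mem_odd ha
            rw [of_symm_of, TensorProduct.map_tmul, h, mul_one, uzpow_one, one_mul,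
              TensorProduct.neg_tmul, Units.neg_smul, one_smul, map_neg]
            rfl
  have h := key (comulExtAlg l)
  rw [← comulExtAlg_ι, ← map_mul] at h
  exact h

/-- The diagonal of `Sᶜ[U ⊕ W] = Sᶜ[U] ⊗ Λᶜ[W]`.  (Interchanging the middle factors `Sᶜ[U]` and
`Λᶜ[W]` brings no sign, since `Sᶜ[U]` sits in degree `0`.) -/
noncomputable def gcomul : GSc F U W →ₗ[F] GSc F U W ⊗[F] GSc F U W :=
  (TensorProduct.tensorTensorTensorComm F (Sc F U) (Sc F U) (ExteriorAlgebra F W)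
    (ExteriorAlgebra F W)).toLinearMap ∘ₗ TensorProduct.map Coalgebra.comul comulExt

/-- The operator `(-1)^{|x|}` on `Sᶜ[U ⊕ W]`. -/
noncomputable def ginvol : GSc F U W →ₗ[F] GSc F U W := invol.lTensor (Sc F U)

/-- The cogenerating morphism `Sᶜ[U ⊕ W] → U ⊕ W`. -/
noncomputable def gcogen : GSc F U W →ₗ[F] U × W :=
  ((TensorProduct.rid F U).toLinearMap ∘ₗ
    TensorProduct.map cogen ExteriorAlgebra.algebraMapInv.toLinearMap).prod
    ((TensorProduct.lid F W).toLinearMap ∘ₗ TensorProduct.map Coalgebra.counit ExteriorAlgebra.ιInv)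

/-- The coderivation of degree `-1` of the graded coalgebra `Sᶜ[U ⊕ W]` whose composite with the
cogenerating morphism is `f : Sᶜ[U] → W`, explicitly `s ⊗ l ↦ Σ s₁ ⊗ f(s₂) ∧ l`.  For degree
reasons, every coderivation of degree `-1` arises in this way, and it is a differential. -/
noncomputable def coder (f : Sc F U →ₗ[F] W) : GSc F U W →ₗ[F] GSc F U W :=
  (TensorProduct.lift
      (LinearMap.mul F (ExteriorAlgebra F W) ∘ₗ ExteriorAlgebra.ι F ∘ₗ f)).lTensor (Sc F U) ∘ₗ
    (TensorProduct.assoc F (Sc F U) (Sc F U) (ExteriorAlgebra F W)).toLinearMap ∘ₗ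
    (Coalgebra.comul (R := F) (A := Sc F U)).rTensor (ExteriorAlgebra F W)

/-- The constituent `Sᶜ[U]` of degree `0` of `Sᶜ[U ⊕ W]`. -/
noncomputable def degZero : Sc F U →ₗ[F] GSc F U W :=
  (TensorProduct.mk F (Sc F U) (ExteriorAlgebra F W)).flip 1

theorem coder_degZero (f : Sc F U →ₗ[F] W) :
    coder f ∘ₗ degZero = (ExteriorAlgebra.ι F).lTensor (Sc F U) ∘ₗ comoduleMap f := by
  have e : (TensorProduct.lift
      (LinearMap.mul F (ExteriorAlgebra F W) ∘ₗ ExteriorAlgebra.ι F ∘ₗ f)).lTensor (Sc F U) ∘ₗ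
      (TensorProduct.assoc F (Sc F U) (Sc F U) (ExteriorAlgebra F W)).toLinearMap ∘ₗ
      (TensorProduct.mk F (Sc F U ⊗[F] Sc F U) (ExteriorAlgebra F W)).flip 1 =
      (ExteriorAlgebra.ι F ∘ₗ f).lTensor (Sc F U) := by
    ext; simp
  rw [comoduleMap, ← LinearMap.comp_assoc, ← LinearMap.lTensor_comp, ← e]
  rfl

theorem ker_coder_degZero (f : Sc F U →ₗ[F] W) :
    LinearMap.ker (coder f ∘ₗ degZero) = (zeroLocus f).toSubmodule := by
  rw [coder_degZero, LinearMap.ker_comp_of_ker_eq_bot]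
  · rfl
  · exact LinearMap.ker_eq_bot.mpr (Module.Flat.lTensor_preserves_injective_linearMap _
      ExteriorAlgebra.ι_leftInverse.injective)

/-- The homology in degree `0` of the differential graded coalgebra `Sᶜ[U ⊕ W]` with the
differential `coder f`, a subcoalgebra of `Sᶜ[U]`: the kernel of the differential on the
constituent `Sᶜ[U]` of degree `0`.  (The constituent of degree `1` is zero, whence there are no
boundaries in degree `0`.) -/
noncomputable def H0 (f : Sc F U →ₗ[F] W) : Subcoalgebra F (Sc F U) where
  toSubmodule := LinearMap.ker (coder f ∘ₗ degZero)
  comul_mem := by rw [ker_coder_degZero]; exact (zeroLocus f).comul_mem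

/-- The composite of `coder f` with the cogenerating morphism is `f` on the degree zero
constituent `Sᶜ[U]`. -/
theorem gcogen_coder (f : Sc F U →ₗ[F] W) (x : Sc F U) :
    gcogen (coder f (degZero x)) = (0, f x) := by
  have h := congr($(coder_degZero f) x)
  simp only [LinearMap.comp_apply] at h
  rw [h]
  have h1 : (gcogen (F := F) (U := U) (W := W)) ∘ₗ (ExteriorAlgebra.ι F).lTensor (Sc F U) =
      LinearMap.inr F U W ∘ₗ (TensorProduct.lid F W).toLinearMap ∘ₗ
        (Coalgebra.counit (R := F) (A := Sc F U)).rTensor W := by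
    refine TensorProduct.ext' fun s w => ?_
    have : ExteriorAlgebra.ιInv (ExteriorAlgebra.ι F w) = w := ExteriorAlgebra.ι_leftInverse w
    simp [gcogen, this, ExteriorAlgebra.algebraMapInv]
  have h2 := congr($h1 (comoduleMap f x))
  simp only [LinearMap.comp_apply] at h2
  rw [h2]
  have h3 : (Coalgebra.counit (R := F) (A := Sc F U)).rTensor W (comoduleMap f x) = 1 ⊗ₜ f x := by
    rw [comoduleMap, LinearMap.comp_apply, ← LinearMap.comp_apply, LinearMap.rTensor_comp_lTensor,
      ← LinearMap.lTensor_comp_rTensor, LinearMap.comp_apply, Coalgebra.rTensor_counit_comul]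
    simp
  rw [h3]; simp

theorem coder_tmul (f : Sc F U →ₗ[F] W) (s : Sc F U) (l : ExteriorAlgebra F W) :
    coder f (s ⊗ₜ l) =
      (LinearMap.lTensor (Sc F U) (((LinearMap.mul F (ExteriorAlgebra F W)).flip l) ∘ₗ
        ExteriorAlgebra.ι F ∘ₗ f)) (Coalgebra.comul (R := F) s) := by
  simp only [coder, LinearMap.comp_apply, LinearMap.rTensor_tmul]
  generalize Coalgebra.comul (R := F) s = t
  induction t using TensorProduct.induction_on with
  | zero => simp
  | add x y hx hy => simp only [map_add, TensorProduct.add_tmul] at *; rw [hx, hy]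
  | tmul a b => simp

/-- `coder f` is a differential. -/
theorem coder_comp_coder [CharZero F] (f : Sc F U →ₗ[F] W) : coder f ∘ₗ coder f = 0 := by
  refine TensorProduct.ext' fun s l => ?_
  set e := ExteriorAlgebra.ι F ∘ₗ f with he
  -- the product `s ↦ Σ f(s₁) ∧ f(s₂)` vanishes
  let m : Sc F U ⊗[F] Sc F U →ₗ[F] ExteriorAlgebra F W :=
    LinearMap.mul' F _ ∘ₗ TensorProduct.map e e
  have hm : ∀ s : Sc F U, m (Coalgebra.comul (R := F) s) = 0 := by
    intro s
    have hsw : m ∘ₗ (TensorProduct.comm F _ _).toLinearMap = -m := by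
      refine TensorProduct.ext' fun a b => ?_
      simpa [m, he] using
        eq_neg_of_add_eq_zero_left (ExteriorAlgebra.ι_add_mul_swap (R := F) (f b) (f a))
    have h := congr($hsw (Coalgebra.comul (R := F) s))
    rw [LinearMap.comp_apply, LinearEquiv.coe_coe, Coalgebra.comm_comul, LinearMap.neg_apply] at h
    have h2 : (2 : F) • m (Coalgebra.comul (R := F) s) = 0 := by
      rw [two_smul]; nth_rewrite 1 [h]; simp
    exact (smul_eq_zero.mp h2).resolve_left two_ne_zero
  let P : (Sc F U ⊗[F] (Sc F U ⊗[F] Sc F U)) →ₗ[F] GSc F U W :=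
    (LinearMap.mulRight F l ∘ₗ m).lTensor (Sc F U)
  have h1 : ∀ t : Sc F U ⊗[F] Sc F U,
      coder f ((LinearMap.lTensor (Sc F U) (((LinearMap.mul F (ExteriorAlgebra F W)).flip l) ∘ₗ
        e)) t) = P (TensorProduct.assoc F _ _ _ ((Coalgebra.comul (R := F)).rTensor _ t)) := by
    intro t
    induction t using TensorProduct.induction_on with
    | zero => simp
    | add x y hx hy => simp only [map_add, hx, hy]
    | tmul a b =>
      rw [LinearMap.lTensor_tmul, coder_tmul, LinearMap.rTensor_tmul]
      generalize Coalgebra.comul (R := F) a = t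
      induction t using TensorProduct.induction_on with
      | zero => simp
      | add x y hx hy => simp only [map_add, TensorProduct.add_tmul, hx, hy]
      | tmul c d => simp [P, m, he, mul_assoc]
  rw [LinearMap.comp_apply, coder_tmul, h1, Coalgebra.coassoc_apply]
  generalize Coalgebra.comul (R := F) s = t
  induction t using TensorProduct.induction_on with
  | zero => simp
  | add x y hx hy => simp only [map_add, hx, hy, LinearMap.zero_apply, add_zero]
  | tmul c d => simp [P, hm]

set_option maxHeartbeats 1600000 in
/-- `coder f` is a graded coderivation of degree `-1`: `Δ D = (D ⊗ 1 + 1 ⊗ D) Δ`, where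
`(1 ⊗ D)(x ⊗ y) = (-1)^{|x|} x ⊗ D(y)`. -/
theorem coder_coderivation (f : Sc F U →ₗ[F] W) :
    gcomul ∘ₗ coder f =
      ((coder f).rTensor _ + TensorProduct.map ginvol (coder f)) ∘ₗ gcomul := by
  set e := ExteriorAlgebra.ι F ∘ₗ f with he
  let c := TensorProduct.tensorTensorTensorComm F (Sc F U) (Sc F U) (ExteriorAlgebra F W)
    (ExteriorAlgebra F W)
  let me : Sc F U →ₗ[F] ExteriorAlgebra F W →ₗ[F] ExteriorAlgebra F W :=
    LinearMap.mul F (ExteriorAlgebra F W) ∘ₗ e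
  let B : Sc F U →ₗ[F] ExteriorAlgebra F W ⊗[F] ExteriorAlgebra F W →ₗ[F]
      ExteriorAlgebra F W ⊗[F] ExteriorAlgebra F W :=
    LinearMap.rTensorHom _ ∘ₗ me + TensorProduct.mapBilinear _ _ _ _ _ invol ∘ₗ me
  let R := (coder f).rTensor (GSc F U W) + TensorProduct.map ginvol (coder f)
  have key : ∀ (s : Sc F U) (z : ExteriorAlgebra F W ⊗[F] ExteriorAlgebra F W),
      c (TensorProduct.map Coalgebra.comul (B.flip z) (Coalgebra.comul (R := F) s)) =
        R (c (Coalgebra.comul (R := F) s ⊗ₜ z)) := by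
    intro s z
    induction z using TensorProduct.induction_on with
    | zero => simp
    | add x y hx hy =>
      rw [map_add, TensorProduct.map_add_right, LinearMap.add_apply, map_add, hx, hy,
        TensorProduct.tmul_add, map_add, map_add]
    | tmul p q =>
      let Z₁ : (Sc F U ⊗[F] Sc F U) ⊗[F] Sc F U →ₗ[F] GSc F U W ⊗[F] GSc F U W :=
        TensorProduct.map ((me.flip p).lTensor _) ((TensorProduct.mk F _ _).flip q)
      let Y₁ : Sc F U ⊗[F] (Sc F U ⊗[F] Sc F U) →ₗ[F] GSc F U W ⊗[F] GSc F U W :=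
        Z₁ ∘ₗ (TensorProduct.assoc F _ _ _).symm.toLinearMap ∘ₗ
          (TensorProduct.comm F _ _).toLinearMap.lTensor _
      let Y₂ : Sc F U ⊗[F] (Sc F U ⊗[F] Sc F U) →ₗ[F] GSc F U W ⊗[F] GSc F U W :=
        TensorProduct.map ((TensorProduct.mk F _ _).flip (invol p)) ((me.flip q).lTensor _)
      have h1 : ∀ t : Sc F U ⊗[F] Sc F U,
          c (TensorProduct.map Coalgebra.comul (B.flip (p ⊗ₜ q)) t) =
            Y₁ (TensorProduct.assoc F _ _ _ ((Coalgebra.comul (R := F)).rTensor _ t)) +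
            Y₂ (TensorProduct.assoc F _ _ _ ((Coalgebra.comul (R := F)).rTensor _ t)) := by
        intro t
        induction t using TensorProduct.induction_on with
        | zero => simp
        | add x y hx hy => simp only [map_add, hx, hy]; abel
        | tmul a b =>
          rw [TensorProduct.map_tmul, LinearMap.rTensor_tmul]
          generalize Coalgebra.comul (R := F) a = t
          induction t using TensorProduct.induction_on with
          | zero => simp
          | add x y hx hy => simp only [map_add, TensorProduct.add_tmul, hx, hy]; abel
          | tmul x y => simp [c, B, Y₁, Y₂, Z₁, TensorProduct.tmul_add]
      have h2 : Y₁ ((Coalgebra.comul (R := F)).lTensor _ (Coalgebra.comul (R := F) s)) =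
          Z₁ ((Coalgebra.comul (R := F)).rTensor _ (Coalgebra.comul (R := F) s)) := by
        have : (TensorProduct.comm F (Sc F U) (Sc F U)).toLinearMap ∘ₗ Coalgebra.comul =
            Coalgebra.comul (R := F) (A := Sc F U) := Coalgebra.comm_comp_comul F _
        simp only [Y₁, LinearMap.comp_apply]
        rw [← LinearMap.comp_apply (LinearMap.lTensor _ _), ← LinearMap.lTensor_comp, this,
          ← Coalgebra.coassoc_apply]
        simp
      have h3 : ∀ t : Sc F U ⊗[F] Sc F U, R (c (t ⊗ₜ (p ⊗ₜ q))) =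
          Z₁ ((Coalgebra.comul (R := F)).rTensor _ t) +
            Y₂ ((Coalgebra.comul (R := F)).lTensor _ t) := by
        intro t
        induction t using TensorProduct.induction_on with
        | zero => simp only [TensorProduct.zero_tmul, map_zero, add_zero]
        | add x y hx hy =>
          rw [TensorProduct.add_tmul, map_add c, map_add R, hx, hy, map_add, map_add Z₁, map_add,
            map_add Y₂]
          exact add_add_add_comm _ _ _ _
        | tmul a b =>
          simp only [R, c, Z₁, Y₂, TensorProduct.tensorTensorTensorComm_tmul, LinearMap.add_apply,
            LinearMap.rTensor_tmul, LinearMap.lTensor_tmul, TensorProduct.map_tmul, coder_tmul]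
          rfl
      rw [h1, h3, Coalgebra.coassoc_apply, h2]
  refine TensorProduct.ext' fun s l => ?_
  have h4 : ∀ t : Sc F U ⊗[F] Sc F U,
      gcomul (LinearMap.lTensor (Sc F U) (((LinearMap.mul F (ExteriorAlgebra F W)).flip l) ∘ₗ
        e) t) = c (TensorProduct.map Coalgebra.comul (B.flip (comulExt l)) t) := by
    intro t
    induction t using TensorProduct.induction_on with
    | zero => simp
    | add x y hx hy => simp only [map_add, hx, hy]
    | tmul a b =>
      have : comulExt (e b * l) = B b (comulExt l) := comulExt_ι_mul (f b) l
      simp only [LinearMap.lTensor_tmul, TensorProduct.map_tmul, gcomul, LinearMap.comp_apply,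
        LinearMap.flip_apply, LinearMap.mul_apply', this]
      rfl
  rw [LinearMap.comp_apply, coder_tmul, h4, key]
  rfl

end GSc

/-! ### Differential graded Lie algebras and contractions onto homology -/

/-- A differential graded Lie algebra over `F`, homologically graded by `ℤ`: the differential
lowers the degree by one, and the bracket obeys the graded sign rules. -/
structure DGLie (F : Type*) [Field F] (g : ℤ → Type*) [∀ n, AddCommGroup (g n)]
    [∀ n, Module F (g n)] where
  d : ∀ i j : ℤ, j + 1 = i → (g i →ₗ[F] g j)
  d_d : ∀ (i j k : ℤ) (hij : j + 1 = i) (hjk : k + 1 = j) (x : g i), d j k hjk (d i j hij x) = 0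
  br : ∀ i j k : ℤ, i + j = k → (g i →ₗ[F] g j →ₗ[F] g k)
  br_skew : ∀ (i j k : ℤ) (h : i + j = k) (h' : j + i = k) (x : g i) (y : g j),
    br i j k h x y = -((i * j).negOnePow • br j i k h' y x)
  br_jacobi : ∀ (i j k ij jk ik n : ℤ) (hij : i + j = ij) (hjk : j + k = jk) (hik : i + k = ik)
    (h₁ : i + jk = n) (h₂ : ij + k = n) (h₃ : j + ik = n) (x : g i) (y : g j) (z : g k),
    br i jk n h₁ x (br j k jk hjk y z) = br ij k n h₂ (br i j ij hij x y) z +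
      (i * j).negOnePow • br j ik n h₃ y (br i k ik hik x z)
  d_br : ∀ (i j k i' j' k' : ℤ) (h : i + j = k) (hi : i' + 1 = i) (hj : j' + 1 = j)
    (hk : k' + 1 = k) (h₁ : i' + j = k') (h₂ : i + j' = k') (x : g i) (y : g j),
    d k k' hk (br i j k h x y) = br i' j k' h₁ (d i i' hi x) y +
      i.negOnePow • br i j' k' h₂ x (d j j' hj y)

section Data

variable {F : Type*} [Field F] {g : ℤ → Type*} [∀ n, AddCommGroup (g n)] [∀ n, Module F (g n)]

/-- The cycles in degree `n`. -/
def DGLie.cycles (L : DGLie F g) (n : ℤ) : Submodule F (g n) :=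
  LinearMap.ker (L.d n (n - 1) (by omega))

/-- The boundaries in degree `n`. -/
def DGLie.boundaries (L : DGLie F g) (n : ℤ) : Submodule F (g n) :=
  LinearMap.range (L.d (n + 1) n rfl)

/-- The homology `H_n` of the underlying chain complex: cycles modulo boundaries. -/
abbrev DGLie.H (L : DGLie F g) (n : ℤ) : Type _ :=
  L.cycles n ⧸ (L.boundaries n).submoduleOf (L.cycles n)

/-- A contraction `(∇, π, h)` of the underlying chain complex onto its homology (which has zero
differential): chain maps `∇` and `π` with `π ∇ = id`, and a homotopy `h` of degree `1` with
`d h + h d = id - ∇ π` that satisfies the side conditions `h h = 0`, `h ∇ = 0`, `π h = 0`. -/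
structure Contraction (L : DGLie F g) where
  nabla : ∀ n, L.H n →ₗ[F] g n
  pi : ∀ n, g n →ₗ[F] L.H n
  h : ∀ i j : ℤ, i + 1 = j → (g i →ₗ[F] g j)
  d_nabla : ∀ (i j : ℤ) (hij : j + 1 = i) (x : L.H i), L.d i j hij (nabla i x) = 0
  pi_d : ∀ (i j : ℤ) (hij : j + 1 = i) (x : g i), pi j (L.d i j hij x) = 0
  pi_nabla : ∀ (n : ℤ) (x : L.H n), pi n (nabla n x) = x
  homotopy : ∀ (i j k : ℤ) (hij : i + 1 = j) (hki : k + 1 = i) (x : g i),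
    L.d j i hij (h i j hij x) + h k i hki (L.d i k hki x) = x - nabla i (pi i x)
  h_h : ∀ (i j k : ℤ) (hij : i + 1 = j) (hjk : j + 1 = k) (x : g i), h j k hjk (h i j hij x) = 0
  h_nabla : ∀ (i j : ℤ) (hij : i + 1 = j) (x : L.H i), h i j hij (nabla i x) = 0
  pi_h : ∀ (i j : ℤ) (hij : i + 1 = j) (x : g i), pi j (h i j hij x) = 0

/-! ### The maps `q`, `J` and the coordinate coalgebras

Only the constituents in degrees `-1` and `-2` of the differential graded Lie algebra matter.  The
suspension `V` has `V₀ = s g₋₁` and `V₋₁ = s g₋₂`; as vector spaces these are `g₋₁` and `g₋₂`, with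
`s` read as the identity.  The relation `d s + s d = 0` gives the differential of `V` the opposite
sign, and likewise for the homotopy. -/

namespace DGLie

variable (L : DGLie F g)

/-- The constituent of degree `0` of the suspension. -/
abbrev V₀ (_L : DGLie F g) : Type _ := g (-1)

/-- The constituent of degree `-1` of the suspension. -/
abbrev V₁ (_L : DGLie F g) : Type _ := g (-2)

/-- The constituent of degree `0` of the suspended homology. -/
abbrev v₀ : Type _ := L.H (-1)

/-- The constituent of degree `-1` of the suspended homology. -/
abbrev v₁ : Type _ := L.H (-2)

/-- The differential of the suspension. -/
def dV : L.V₀ →ₗ[F] L.V₁ := -L.d (-1) (-2) rfl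

/-- The bracket in degree `-1`, a symmetric bilinear map. -/
def bracket : L.V₀ →ₗ[F] L.V₀ →ₗ[F] L.V₁ := L.br (-1) (-1) (-2) rfl

/-- The homogeneous quadratic map `q(x) = ½ [x, x]`. -/
noncomputable def q (x : L.V₀) : L.V₁ := (2⁻¹ : F) • L.bracket x x

/-- The algebraic map `J = d + q`. -/
noncomputable def J (x : L.V₀) : L.V₁ := L.dV x + L.q x

/-- The linear map `Q : Sᶜ[V₀] → Sᶜ₂[V₀] → V₋₁`, the formal map of `q`. -/
noncomputable def Q : Sc F L.V₀ →ₗ[F] L.V₁ := (2⁻¹ : F) • cup L.bracket cogen cogen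

/-- The formal map `d + Q : Sᶜ[V₀] → V₋₁` of `J`.  The coderivation with this corestriction is the
differential `d + ∂` of the classifying coalgebra. -/
noncomputable def formalJ : Sc F L.V₀ →ₗ[F] L.V₁ := L.dV ∘ₗ cogen + L.Q

/-- The coordinate coalgebra of the zero locus `J⁻¹(0)`. -/
noncomputable def coordV : Subcoalgebra F (Sc F L.V₀) := zeroLocus L.formalJ

theorem formalJ_isFormalMapOf [CharZero F] : IsFormalMapOf L.formalJ L.J := by
  refine ⟨3, fun n hn u => ?_, fun u => ?_⟩
  · simp only [formalJ, Q, LinearMap.add_apply, LinearMap.comp_apply, LinearMap.smul_apply,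
      cogen_ι_pow, cup_cogen_ι_pow]
    rw [if_neg (by omega), if_neg (by omega)]; simp
  · simp only [formalJ, Q, map_smul, LinearMap.add_apply, LinearMap.comp_apply,
      LinearMap.smul_apply, cogen_ι_pow, cup_cogen_ι_pow, Finset.sum_range_succ, J, q]
    simp [smul_smul]

end DGLie

namespace Contraction

variable {L : DGLie F g} (c : Contraction L)

/-- The homotopy of the suspension. -/
def hV : L.V₁ →ₗ[F] L.V₀ := -c.h (-2) (-1) rfl

/-- The component `q_B = d h q` of `q` into `B₋₁ = d V₀`. -/
noncomputable def qB (x : L.V₀) : L.V₁ := L.dV (c.hV (L.q x))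

/-- The formal map `Q_B` of `q_B`. -/
noncomputable def QB : Sc F L.V₀ →ₗ[F] L.V₁ := L.dV ∘ₗ c.hV ∘ₗ L.Q

/-- The formal map `d + Q_B`.  The coderivation with this corestriction is the differential
`d + ∂_B`. -/
noncomputable def formalJB : Sc F L.V₀ →ₗ[F] L.V₁ := L.dV ∘ₗ cogen + c.QB

/-- The left-hand side of the equation `x₂ + h(q_B(x)) = 0`, where `x₂ = h(d(x))` is the component
of `x` in `A₀ = h d V₀`. -/
noncomputable def eqM (x : L.V₀) : L.V₀ := c.hV (L.dV x) + c.hV (c.qB x)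

/-- The formal map of `eqM`. -/
noncomputable def formalEqM : Sc F L.V₀ →ₗ[F] L.V₀ := c.hV ∘ₗ L.dV ∘ₗ cogen + c.hV ∘ₗ c.QB

/-- The coordinate coalgebra of the variety of all `x` with `x₂ + h(q_B(x)) = 0`. -/
noncomputable def coordM : Subcoalgebra F (Sc F L.V₀) := zeroLocus c.formalEqM

theorem formalEqM_isFormalMapOf [CharZero F] : IsFormalMapOf c.formalEqM c.eqM := by
  refine ⟨3, fun n hn u => ?_, fun u => ?_⟩
  · simp only [formalEqM, QB, DGLie.Q, LinearMap.add_apply, LinearMap.comp_apply,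
      LinearMap.smul_apply, cogen_ι_pow, cup_cogen_ι_pow]
    rw [if_neg (by omega), if_neg (by omega)]; simp
  · simp only [formalEqM, QB, DGLie.Q, map_smul, LinearMap.add_apply, LinearMap.comp_apply,
      LinearMap.smul_apply, cogen_ι_pow, cup_cogen_ι_pow, Finset.sum_range_succ, eqM, qB, DGLie.q]
    simp [smul_smul]

/-! ### The universal twisting cochain and the perturbed differential -/

/-- The constituents `τ^ℓ`, restricted to the constituent `Sᶜ[v₀]` of degree `0` of `Sᶜ[v]`:
`τ¹ = ∇ s⁻¹` on the cogenerators and `τ^ℓ = ½ h([τ¹, τ^{ℓ-1}] + ⋯ + [τ^{ℓ-1}, τ¹])` for `ℓ ≥ 2`.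
(For degree reasons, in degrees other than `0` the twisting cochain is `∇ s⁻¹` on `v₋₁` and zero
otherwise, and these values do not enter the recursion on `Sᶜ[v₀]`.) -/
noncomputable def tauL : ℕ → (Sc F L.v₀ →ₗ[F] g (-1))
  | 0 => 0
  | 1 => c.nabla (-1) ∘ₗ cogen
  | n + 2 => (2⁻¹ : F) • (c.h (-2) (-1) rfl ∘ₗ
      ∑ i : Fin (n + 1), cup L.bracket (tauL (i + 1)) (tauL (n + 1 - i)))
decreasing_by all_goals omega

/-- The sum `[τ¹, τ^{ℓ-1}] + ⋯ + [τ^{ℓ-1}, τ¹]` for `ℓ ≥ 2`. -/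
noncomputable def bracketSum : ℕ → (Sc F L.v₀ →ₗ[F] g (-2))
  | 0 => 0
  | 1 => 0
  | n + 2 => ∑ i : Fin (n + 1), cup L.bracket (c.tauL (i + 1)) (c.tauL (n + 1 - i))

theorem vanishBelow_tauL (n : ℕ) : VanishBelow n (c.tauL n) := by
  induction n using Nat.strong_induction_on with
  | _ n ih =>
    rcases n with _ | _ | n
    · intro m hm; omega
    · intro m hm x hx
      obtain rfl : m = 0 := by omega
      rw [Fil, pow_zero] at hx
      obtain ⟨r, rfl⟩ := Submodule.mem_one.mp hx
      rw [tauL, LinearMap.comp_apply, cogen_algebraMap, map_zero]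
    · intro m hm x hx
      rw [tauL, LinearMap.smul_apply, LinearMap.comp_apply, LinearMap.sum_apply,
        Finset.sum_eq_zero, map_zero, smul_zero]
      intro i _
      exact (ih (i + 1) (by omega)).cup L.bracket (ih (n + 1 - i) (by omega)) m (by omega) x hx

theorem vanishBelow_bracketSum (n : ℕ) : VanishBelow n (c.bracketSum n) := by
  rcases n with _ | _ | n
  · intro m hm x hx; rfl
  · intro m hm x hx; rfl
  · intro m hm x hx
    rw [bracketSum, LinearMap.sum_apply, Finset.sum_eq_zero]
    intro i _
    exact (c.vanishBelow_tauL (i + 1)).cup L.bracket (c.vanishBelow_tauL (n + 1 - i)) m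
      (by omega) x hx

/-- The degree zero constituent `Sᶜ[v₀] → g₋₁` of the universal twisting cochain
`τ = τ¹ + τ² + ⋯`; followed by the suspension, it is a map `Sᶜ[v₀] → V₀`. -/
noncomputable def tau : Sc F L.v₀ →ₗ[F] L.V₀ :=
  pointwiseSum c.tauL (VanishBelow.locallyFinite c.vanishBelow_tauL)

/-- The corestriction `½ π([τ¹, τ^{ℓ-1}] + ⋯ + [τ^{ℓ-1}, τ¹]) : Sᶜ[v₀] → v₋₁` of the coderivation
`𝒟^{ℓ-1}` of `Sᶜ[v]`. -/
noncomputable def corestrictionL (n : ℕ) : Sc F L.v₀ →ₗ[F] L.v₁ :=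
  (2⁻¹ : F) • (c.pi (-2) ∘ₗ c.bracketSum n)

theorem vanishBelow_corestrictionL (n : ℕ) : VanishBelow n (c.corestrictionL n) := by
  intro m hm x hx
  rw [corestrictionL, LinearMap.smul_apply, LinearMap.comp_apply,
    c.vanishBelow_bracketSum n m hm x hx, map_zero, smul_zero]

/-- The corestriction `Sᶜ[v₀] → v₋₁` of the coalgebra differential `𝒟 = 𝒟¹ + 𝒟² + ⋯`. -/
noncomputable def corestriction : Sc F L.v₀ →ₗ[F] L.v₁ :=
  pointwiseSum c.corestrictionL (VanishBelow.locallyFinite c.vanishBelow_corestrictionL)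

/-- The Kuranishi coalgebra `H₀(Sᶜ_𝒟[v]) ⊆ Sᶜ[v₀]`, where `𝒟` is the coderivation of `Sᶜ[v]` with
the corestriction above. -/
noncomputable def kuranishi : Subcoalgebra F (Sc F L.v₀) := H0 c.corestriction

end Contraction

end Data

end FormalKuranishi

open FormalKuranishi

/-!
The symmetric coalgebra `Sᶜ[U]` is cofree in characteristic zero, and the theorem is the implicit
function theorem for `x ↦ x - h q(x)`, read off on corestrictions.

*Cofreeness.*  The convolution product of `ι ∘ cogen` with the projection to degree `n` is `n + 1`
times the projection to degree `n + 1` (`smul_weight_succ`).  Hence a morphism from any coalgebra to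
`Sᶜ[U]` is determined, degree by degree, by its corestriction (`coalgHom_ext`).  Conversely, a
linear map `f : Sᶜ[X] → U` with `f(1) = 0` has the convolution exponential `Σ fⁿ / n!` as its adjoint
(`exists_isAdjoint`).

*The straightening.*  The sum `τ` solves `τ = ∇ s⁻¹ + ½ h [τ, τ]` (`tau_eq`).  Let `Θ` be the formal
endomorphism `x ↦ x - h q(x)` of `V₀`, with the unsuspended `h`; as its linear part is the identity,
it is injective (`injective_of_vanishBelow_two`).  The equation of `ℳ` is `h d Θ(x) = 0`
(`formalEqM_eq_straightening`), so that `Θ` carries `C[ℳ]` into `Sᶜ[ker h d]`, on which `Sᶜ[∇ π]` is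
the identity (`map_eq_self_of_mem_zeroLocus`).  Comparison of corestrictions yields `Θ φ = Sᶜ[∇]`,
`Sᶜ[π] Θ = Sᶜ[π]` and `Sᶜ[π] φ = id` for the adjoint `φ` of `τ`, and therefore `φ Sᶜ[π] = id` on
`C[ℳ]` (`of_isAdjoint_map_pi`).

*The Kuranishi coalgebra.*  Since `d h = id - ∇ π` in degree `-2`, the composite of `d + Q` with `φ`
is `∇` after the corestriction of `𝒟` (`formalJ_comp_of_isAdjoint`).  As `φ` and `∇` are injective,
`φ x` lies in `C[𝒱]` if and only if `x` lies in the Kuranishi coalgebra.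
-/

namespace FormalKuranishi

/-! ### Products in `Hom(Sᶜ[U], V)` and locally finite sums -/

section Cup

variable {F : Type*} [Field F] {C D V W : Type*} [AddCommGroup C] [Module F C] [Coalgebra F C]
  [AddCommGroup D] [Module F D] [Coalgebra F D]
  [AddCommGroup V] [Module F V] [AddCommGroup W] [Module F W]

theorem cup_add_left (B : V →ₗ[F] V →ₗ[F] W) (a a' b : C →ₗ[F] V) :
    cup B (a + a') b = cup B a b + cup B a' b := by
  simp only [cup, TensorProduct.map_add_left, LinearMap.add_comp, LinearMap.comp_add]

theorem cup_add_right (B : V →ₗ[F] V →ₗ[F] W) (a b b' : C →ₗ[F] V) :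
    cup B a (b + b') = cup B a b + cup B a b' := by
  simp only [cup, TensorProduct.map_add_right, LinearMap.add_comp, LinearMap.comp_add]

theorem cup_sub_left (B : V →ₗ[F] V →ₗ[F] W) (a a' b : C →ₗ[F] V) :
    cup B (a - a') b = cup B a b - cup B a' b := by
  rw [eq_sub_iff_add_eq, ← cup_add_left, sub_add_cancel]

theorem cup_sub_right (B : V →ₗ[F] V →ₗ[F] W) (a b b' : C →ₗ[F] V) :
    cup B a (b - b') = cup B a b - cup B a b' := by
  rw [eq_sub_iff_add_eq, ← cup_add_right, sub_add_cancel]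

theorem cup_sum_left {ι : Type*} (s : Finset ι) (B : V →ₗ[F] V →ₗ[F] W) (a : ι → C →ₗ[F] V)
    (b : C →ₗ[F] V) : cup B (∑ i ∈ s, a i) b = ∑ i ∈ s, cup B (a i) b :=
  map_sum (AddMonoidHom.mk' (fun a => cup B a b) fun a a' => cup_add_left B a a' b) a s

theorem cup_sum_right {ι : Type*} (s : Finset ι) (B : V →ₗ[F] V →ₗ[F] W) (a : C →ₗ[F] V)
    (b : ι → C →ₗ[F] V) : cup B a (∑ i ∈ s, b i) = ∑ i ∈ s, cup B a (b i) :=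
  map_sum (AddMonoidHom.mk' (fun b => cup B a b) fun b b' => cup_add_right B a b b') b s

theorem cup_comp (B : V →ₗ[F] V →ₗ[F] W) (a b : C →ₗ[F] V) (φ : D →ₗc[F] C) :
    cup B a b ∘ₗ φ.toLinearMap = cup B (a ∘ₗ φ.toLinearMap) (b ∘ₗ φ.toLinearMap) := by
  simp only [cup, LinearMap.comp_assoc, TensorProduct.map_comp, CoalgHom.map_comp_comul]

end Cup

section LocallyFinite

variable {F : Type*} [Field F] {U V W : Type*} [AddCommGroup U] [Module F U]
  [AddCommGroup V] [Module F V] [AddCommGroup W] [Module F W]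

namespace VanishBelow

theorem zero (f : Sc F U →ₗ[F] W) : VanishBelow 0 f := fun _ h => absurd h (Nat.not_lt_zero _)

theorem mono {m n : ℕ} (h : m ≤ n) {f : Sc F U →ₗ[F] W} (hf : VanishBelow n f) :
    VanishBelow m f := fun k hk => hf k (hk.trans_le h)

theorem add {n : ℕ} {f g : Sc F U →ₗ[F] W} (hf : VanishBelow n f) (hg : VanishBelow n g) :
    VanishBelow n (f + g) := fun m hm x hx => by
  rw [LinearMap.add_apply, hf m hm x hx, hg m hm x hx, add_zero]

theorem comp {n : ℕ} {f : Sc F U →ₗ[F] V} (hf : VanishBelow n f) (A : V →ₗ[F] W) :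
    VanishBelow n (A ∘ₗ f) := fun m hm x hx => by
  rw [LinearMap.comp_apply, hf m hm x hx, map_zero]

theorem smul {n : ℕ} {f : Sc F U →ₗ[F] V} (hf : VanishBelow n f) (r : F) :
    VanishBelow n (r • f) := fun m hm x hx => by
  rw [LinearMap.smul_apply, hf m hm x hx, smul_zero]

end VanishBelow

theorem cogen_one : cogen (1 : Sc F U) = 0 := by
  simpa using cogen_algebraMap (U := U) (1 : F)

theorem one_mem_Fil (n : ℕ) : (1 : Sc F U) ∈ Fil F U n :=
  Fil_mono (Nat.zero_le n) (by rw [Fil, pow_zero]; exact Submodule.one_le.mp le_rfl)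

theorem vanishBelow_one_iff {f : Sc F U →ₗ[F] W} : VanishBelow 1 f ↔ f 1 = 0 := by
  refine ⟨fun h => h 0 Nat.one_pos 1 (one_mem_Fil 0), fun h m hm x hx => ?_⟩
  obtain rfl : m = 0 := by omega
  rw [Fil, pow_zero] at hx
  obtain ⟨r, rfl⟩ := Submodule.mem_one.mp hx
  rw [Algebra.algebraMap_eq_smul_one, map_smul, h, smul_zero]

theorem vanishBelow_cogen : VanishBelow 1 (cogen (F := F) (U := U)) :=
  vanishBelow_one_iff.mpr cogen_one

theorem pointwiseSum_eq_sum_range {f : ℕ → Sc F U →ₗ[F] W} (hf : ∀ n, VanishBelow n (f n))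
    {m : ℕ} {x : Sc F U} (hx : x ∈ Fil F U m) :
    pointwiseSum f (VanishBelow.locallyFinite hf) x = ∑ n ∈ Finset.range (m + 1), f n x := by
  refine finsum_eq_sum_of_support_subset _ fun n hn => ?_
  rw [Finset.coe_range, Set.mem_Iio]
  by_contra h
  exact hn (hf n m (by omega) x hx)

theorem comp_pointwiseSum {f : ℕ → Sc F U →ₗ[F] V} (hf : ∀ n, VanishBelow n (f n))
    (A : V →ₗ[F] W) : A ∘ₗ pointwiseSum f (VanishBelow.locallyFinite hf) =
      pointwiseSum (fun n => A ∘ₗ f n) (VanishBelow.locallyFinite fun n => (hf n).comp A) := by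
  ext1 x
  obtain ⟨m, hm⟩ := exists_mem_Fil x
  rw [LinearMap.comp_apply, pointwiseSum_eq_sum_range hf hm,
    pointwiseSum_eq_sum_range (fun n => (hf n).comp A) hm, map_sum]
  rfl

theorem pointwiseSum_sub_sum_vanishBelow {f : ℕ → Sc F U →ₗ[F] W}
    (hf : ∀ n, VanishBelow n (f n)) (N : ℕ) :
    VanishBelow N (pointwiseSum f (VanishBelow.locallyFinite hf) -
      ∑ n ∈ Finset.range N, f n) := by
  intro m hm x hx
  have hx' : x ∈ Fil F U (N - 1) := Fil_mono (by omega) hx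
  rw [LinearMap.sub_apply, pointwiseSum_eq_sum_range hf hx', LinearMap.sum_apply,
    show N - 1 + 1 = N by omega, sub_self]

theorem VanishBelow.sum_antidiagonal_cup (B : V →ₗ[F] V →ₗ[F] W) {a b : ℕ → Sc F U →ₗ[F] V}
    (ha : ∀ n, VanishBelow n (a n)) (hb : ∀ n, VanishBelow n (b n)) (n : ℕ) :
    VanishBelow n (∑ p ∈ Finset.HasAntidiagonal.antidiagonal n, FormalKuranishi.cup B (a p.1) (b p.2)) := by
  intro m hm x hx
  rw [LinearMap.sum_apply]
  refine Finset.sum_eq_zero fun p hp => ?_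
  rw [Finset.HasAntidiagonal.mem_antidiagonal] at hp
  exact (ha p.1).cup B (hb p.2) m (by omega) x hx

/-- The Cauchy product formula for the products of locally finite sums. -/
theorem cup_pointwiseSum (B : V →ₗ[F] V →ₗ[F] W) {a b : ℕ → Sc F U →ₗ[F] V}
    (ha : ∀ n, VanishBelow n (a n)) (hb : ∀ n, VanishBelow n (b n)) :
    cup B (pointwiseSum a (VanishBelow.locallyFinite ha))
        (pointwiseSum b (VanishBelow.locallyFinite hb)) =
      pointwiseSum (fun n => ∑ p ∈ Finset.HasAntidiagonal.antidiagonal n, cup B (a p.1) (b p.2))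
        (VanishBelow.locallyFinite (VanishBelow.sum_antidiagonal_cup B ha hb)) := by
  ext1 x
  obtain ⟨m, hm⟩ := exists_mem_Fil x
  rw [pointwiseSum_eq_sum_range (VanishBelow.sum_antidiagonal_cup B ha hb) hm]
  set A := pointwiseSum a (VanishBelow.locallyFinite ha)
  set A' := ∑ n ∈ Finset.range (m + 1), a n with hA'
  set B' := ∑ n ∈ Finset.range (m + 1), b n with hB'
  set b' := pointwiseSum b (VanishBelow.locallyFinite hb)
  -- on `Fil m`, both factors may be replaced by partial sums
  have h1 : cup B (A - A') b' x = 0 :=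
    (pointwiseSum_sub_sum_vanishBelow ha (m + 1)).cup B (.zero b') m (by omega) x hm
  have h2 : cup B A' (b' - B') x = 0 :=
    (VanishBelow.zero A').cup B (pointwiseSum_sub_sum_vanishBelow hb (m + 1)) m (by omega) x hm
  rw [cup_sub_left, LinearMap.sub_apply, sub_eq_zero] at h1
  rw [cup_sub_right, LinearMap.sub_apply, sub_eq_zero] at h2
  rw [h1, h2, hA', hB', cup_sum_left, LinearMap.sum_apply]
  simp only [cup_sum_right, LinearMap.sum_apply]
  rw [← Finset.sum_product', ← Finset.sum_filter_add_sum_filter_not _ (fun p : ℕ × ℕ => p.1 + p.2 < m + 1),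
    Finset.sum_eq_zero (s := Finset.filter (fun p : ℕ × ℕ => ¬ p.1 + p.2 < m + 1) _), add_zero,
    ← Finset.sum_fiberwise_of_maps_to (t := Finset.range (m + 1)) (g := fun p : ℕ × ℕ => p.1 + p.2)]
  · refine Finset.sum_congr rfl fun n hn => Finset.sum_congr ?_ fun _ _ => rfl
    ext p
    simp only [Finset.mem_filter, Finset.mem_product, Finset.mem_range,
      Finset.HasAntidiagonal.mem_antidiagonal] at hn ⊢
    omega
  · intro p hp
    simpa using (Finset.mem_filter.mp hp).2
  · intro p hp
    have := (Finset.mem_filter.mp hp).2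
    exact (ha p.1).cup B (hb p.2) m (by omega) x hm

end LocallyFinite

/-! ### The grading of the symmetric coalgebra, and uniqueness of adjoints -/

section Weight

variable {F : Type*} [Field F] {U : Type*} [AddCommGroup U] [Module F U]

/-- The morphism of algebras `Sᶜ[U] → Sᶜ[U][X]` that multiplies the symmetric copower of degree `n`
by `Xⁿ`. -/
noncomputable def scaling : Sc F U →ₐ[F] Polynomial (Sc F U) :=
  SymmetricAlgebra.lift ((Polynomial.monomial 1).restrictScalars F ∘ₗ SymmetricAlgebra.ι F U)

theorem scaling_ι (u : U) :
    scaling (SymmetricAlgebra.ι F U u) = Polynomial.monomial 1 (SymmetricAlgebra.ι F U u) := by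
  simp [scaling]

/-- The projection of `Sᶜ[U]` onto the symmetric copower of degree `n`. -/
noncomputable def weight (n : ℕ) : Sc F U →ₗ[F] Sc F U :=
  (Polynomial.lcoeff (Sc F U) n).restrictScalars F ∘ₗ scaling.toLinearMap

theorem weight_apply (n : ℕ) (x : Sc F U) : weight n x = (scaling x).coeff n := rfl

theorem eval_one_scaling (x : Sc F U) : (scaling x).eval 1 = x := by
  have h : (((Polynomial.aeval (1 : Sc F U)).restrictScalars F).comp scaling) =
      AlgHom.id F (Sc F U) := by
    ext u; simp [scaling_ι]
  simpa [Polynomial.aeval_def] using congr($h x)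

theorem weight_zero (x : Sc F U) :
    weight 0 x = algebraMap F (Sc F U) (Coalgebra.counit (R := F) x) := by
  have h : (((Polynomial.aeval (0 : Sc F U)).restrictScalars F).comp scaling) =
      (Algebra.ofId F (Sc F U)).comp (Bialgebra.counitAlgHom F (Sc F U)) := by
    ext u; simp [scaling_ι, SymmetricAlgebra.algebraMapInv_ι]
  rw [weight_apply, Polynomial.coeff_zero_eq_eval_zero]
  refine Eq.trans ?_ congr($h x)
  simp

theorem ext_weight {x y : Sc F U} (h : ∀ n, weight n x = weight n y) : x = y := by
  rw [← eval_one_scaling x, ← eval_one_scaling y, Polynomial.ext (p := scaling x) (q := scaling y) h]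

theorem ι_mem_Fil_one (u : U) : SymmetricAlgebra.ι F U u ∈ Fil F U 1 := by
  rw [Fil, pow_one]; exact Submodule.mem_sup_right ⟨u, rfl⟩

theorem mul_mem_Fil {m n : ℕ} {x y : Sc F U} (hx : x ∈ Fil F U m) (hy : y ∈ Fil F U n) :
    x * y ∈ Fil F U (m + n) := by
  rw [Fil, pow_add]; exact Submodule.mul_mem_mul hx hy

theorem weight_algebraMap (r : F) {n : ℕ} (hn : n ≠ 0) : weight n (algebraMap F (Sc F U) r) = 0 := by
  rw [weight_apply, AlgHom.commutes]
  exact Polynomial.coeff_C_of_ne_zero hn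

theorem weight_ι (u : U) (n : ℕ) :
    weight n (SymmetricAlgebra.ι F U u) = if n = 1 then SymmetricAlgebra.ι F U u else 0 := by
  rw [weight_apply, scaling_ι, Polynomial.coeff_monomial]
  simp only [eq_comm]

theorem weight_mul (n : ℕ) (x y : Sc F U) : weight n (x * y) =
    ∑ p ∈ Finset.HasAntidiagonal.antidiagonal n, weight p.1 x * weight p.2 y := by
  rw [weight_apply, map_mul, Polynomial.coeff_mul]
  rfl

theorem weight_mem_Fil (n : ℕ) (x : Sc F U) : weight n x ∈ Fil F U n := by
  induction x using SymmetricAlgebra.induction generalizing n with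
  | algebraMap r =>
    rcases eq_or_ne n 0 with rfl | hn
    · rw [weight_zero, Algebra.algebraMap_eq_smul_one]
      exact Submodule.smul_mem _ _ (one_mem_Fil 0)
    · rw [weight_algebraMap r hn]; exact zero_mem _
  | ι u =>
    rw [weight_ι]
    split_ifs with h
    · subst h; exact ι_mem_Fil_one u
    · exact zero_mem _
  | mul a b ha hb =>
    rw [weight_mul]
    refine sum_mem fun p hp => ?_
    rw [← Finset.HasAntidiagonal.mem_antidiagonal.mp hp]
    exact mul_mem_Fil (ha _) (hb _)
  | add a b ha hb => rw [map_add]; exact add_mem (ha n) (hb n)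

theorem vanishBelow_weight (n : ℕ) : VanishBelow n (weight (F := F) (U := U) n) := by
  intro m hm x hx
  induction hx using Submodule.pow_induction_on_left' generalizing n with
  | algebraMap r => exact weight_algebraMap r (by omega)
  | add x y i _ _ hx hy => rw [map_add, hx n hm, hy n hm, add_zero]
  | mem_mul z hz i x _ ih =>
    obtain ⟨_, hr, _, ⟨u, rfl⟩, rfl⟩ := Submodule.mem_sup.mp hz
    obtain ⟨r, rfl⟩ := Submodule.mem_one.mp hr
    rw [weight_mul]
    refine Finset.sum_eq_zero fun p hp => ?_
    have hp' := Finset.HasAntidiagonal.mem_antidiagonal.mp hp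
    rcases le_or_gt p.2 i with h | h
    · rw [map_add, weight_algebraMap r (by omega), weight_ι, if_neg (by omega), add_zero, zero_mul]
    · rw [ih p.2 h, mul_zero]

theorem eq_sum_weight {N : ℕ} {x : Sc F U} (hx : ∀ n ≥ N, weight n x = 0) :
    x = ∑ n ∈ Finset.range N, weight n x := by
  conv_lhs => rw [← eval_one_scaling x]
  rw [Polynomial.eval_eq_sum_range' (n := max N ((scaling x).natDegree + 1)) (by omega)]
  simp only [one_pow, mul_one]
  rw [← Finset.sum_subset (Finset.range_subset_range.mpr (le_max_left N _))]
  · rfl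
  · intro n _ hn
    exact hx n (by simpa using hn)

/-- The Euler operator `x ↦ Σ cogen(x₁) x₂` is multiplication by `n` on the symmetric copower of
degree `n`. -/
theorem smul_weight_succ (n : ℕ) : ((n + 1 : ℕ) : F) • weight (F := F) (U := U) (n + 1) =
    cup (LinearMap.mul F (Sc F U)) (SymmetricAlgebra.ι F U ∘ₗ cogen) (weight n) := by
  -- in generating functions: the derivative of `scaling` is the convolution `G` of `ι ∘ cogen` and
  -- `scaling`, both being `scaling`-derivations with the same values on `ι`
  let e : Sc F U →ₗ[F] Polynomial (Sc F U) :=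
    (Polynomial.CAlgHom (R := F)).toLinearMap ∘ₗ SymmetricAlgebra.ι F U ∘ₗ cogen
  let S : Sc F U →ₗ[F] Polynomial (Sc F U) := scaling.toLinearMap
  let G : Sc F U ⊗[F] Sc F U →ₗ[F] Polynomial (Sc F U) :=
    LinearMap.mul' F _ ∘ₗ TensorProduct.map e S
  let E : Sc F U ⊗[F] Sc F U →ₗ[F] Polynomial (Sc F U) :=
    LinearMap.mul' F _ ∘ₗ TensorProduct.map (Algebra.linearMap F _ ∘ₗ Coalgebra.counit) S
  have hE : ∀ x, E (Coalgebra.comul (R := F) x) = scaling x := by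
    intro x
    have : E = LinearMap.mul' F _ ∘ₗ TensorProduct.map (Algebra.linearMap F _) S ∘ₗ
        (Coalgebra.counit (R := F)).rTensor _ := by
      ext; simp [E]
    rw [this, LinearMap.comp_apply, LinearMap.comp_apply, Coalgebra.rTensor_counit_comul]
    simp [S]
  have hG : ∀ s t, G (s * t) = E s * G t + E t * G s := by
    intro s t
    induction s using TensorProduct.induction_on with
    | zero => simp
    | add x y hx hy => rw [add_mul, map_add, hx, hy, map_add, map_add]; ring
    | tmul a b =>
      induction t using TensorProduct.induction_on with
      | zero => simp
      | add x y hx hy => rw [mul_add, map_add, hx, hy, map_add, map_add]; ring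
      | tmul c d =>
        simp only [Algebra.TensorProduct.tmul_mul_tmul, G, E, LinearMap.comp_apply,
          TensorProduct.map_tmul, LinearMap.mul'_apply, S, AlgHom.toLinearMap_apply, map_mul, e,
          cogen_mul, map_add, map_smul, Algebra.linearMap_apply, Algebra.smul_def, AlgHom.commutes]
        ring
  have key : ∀ x : Sc F U, Polynomial.derivative (scaling x) =
      G (Coalgebra.comul (R := F) x) := by
    intro x
    induction x using SymmetricAlgebra.induction with
    | algebraMap r =>
      rw [AlgHom.commutes, Bialgebra.comul_algebraMap, Algebra.TensorProduct.algebraMap_apply]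
      simp [G, e, cogen_algebraMap]
    | ι u =>
      simp [scaling_ι, G, e, S, cogen_ι, cogen_one]
    | mul a b ha hb =>
      rw [map_mul, Polynomial.derivative_mul, ha, hb, Bialgebra.comul_mul, hG, hE, hE]
      ring
    | add a b ha hb => simp only [map_add, ha, hb]
  ext1 x
  have h := congr(Polynomial.coeff $(key x) n)
  rw [Polynomial.coeff_derivative] at h
  have hc : ∀ t : Sc F U ⊗[F] Sc F U, (G t).coeff n =
      TensorProduct.lift (LinearMap.mul F (Sc F U))
        (TensorProduct.map (SymmetricAlgebra.ι F U ∘ₗ cogen) (weight n) t) := by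
    intro t
    induction t using TensorProduct.induction_on with
    | zero => simp
    | add x y hx hy => rw [map_add, Polynomial.coeff_add, hx, hy, map_add, map_add]
    | tmul a b =>
      simp [G, e, S, weight_apply]
  rw [hc] at h
  rw [cup, LinearMap.comp_apply, LinearMap.comp_apply, ← h, LinearMap.smul_apply, weight_apply,
    Algebra.smul_def, mul_comm]
  simp

/-- Cofreeness of `Sᶜ[U]`, uniqueness: a morphism of coalgebras into `Sᶜ[U]` is determined by its
composite with the cogenerating morphism.  No conilpotency of the source is needed. -/
theorem coalgHom_ext [CharZero F] {C : Type*} [AddCommGroup C] [Module F C] [Coalgebra F C]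
    {f g : C →ₗc[F] Sc F U} (h : ∀ x, cogen (f x) = cogen (g x)) : f = g := by
  have h' : cogen ∘ₗ f.toLinearMap = cogen ∘ₗ g.toLinearMap := LinearMap.ext h
  have hw : ∀ n, weight n ∘ₗ f.toLinearMap = weight n ∘ₗ g.toLinearMap := by
    intro n
    induction n with
    | zero =>
      ext1 x
      simp [weight_zero]
    | succ n ih =>
      have hn : ((n + 1 : ℕ) : F) ≠ 0 := Nat.cast_ne_zero.mpr n.succ_ne_zero
      refine smul_right_injective _ hn ?_
      simp only
      rw [← LinearMap.smul_comp, ← LinearMap.smul_comp, smul_weight_succ, cup_comp, cup_comp, ih,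
        LinearMap.comp_assoc, h', LinearMap.comp_assoc]
  ext x
  exact ext_weight fun n => congr($(hw n) x)

end Weight

/-! ### Convolution exponentials, and existence of adjoints -/

section DividedPowers

open WithConv

variable {F : Type*} [Field F] {C A B : Type*} [AddCommGroup C] [Module F C] [Coalgebra F C]
  [CommRing A] [Algebra F A] [CommRing B] [Algebra F B]

theorem ofConv_mul_eq_cup (a b : WithConv (C →ₗ[F] A)) :
    (a * b).ofConv = cup (LinearMap.mul F A) a.ofConv b.ofConv := rfl

theorem algHom_comp_ofConv_pow (h : A →ₐ[F] B) (a : C →ₗ[F] A) (n : ℕ) :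
    h.toLinearMap ∘ₗ (toConv a ^ n).ofConv = (toConv (h.toLinearMap ∘ₗ a) ^ n).ofConv := by
  induction n with
  | zero =>
    ext1 x
    simp [LinearMap.convOne_def]
  | succ n ih => rw [pow_succ, LinearMap.algHom_comp_convMul_distrib, ih, pow_succ]

/-- The divided power `aⁿ / n!` of a linear map `a : C → A` in the convolution algebra
`Hom(C, A)`. -/
noncomputable def convDivPow (n : ℕ) (a : C →ₗ[F] A) : C →ₗ[F] A :=
  (n.factorial : F)⁻¹ • (toConv a ^ n).ofConv

theorem convDivPow_zero (a : C →ₗ[F] A) :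
    convDivPow 0 a = Algebra.linearMap F A ∘ₗ Coalgebra.counit := by
  simp [convDivPow, LinearMap.convOne_def]

theorem convDivPow_one (a : C →ₗ[F] A) : convDivPow 1 a = a := by
  simp [convDivPow]

theorem algHom_comp_convDivPow (h : A →ₐ[F] B) (n : ℕ) (a : C →ₗ[F] A) :
    h.toLinearMap ∘ₗ convDivPow n a = convDivPow n (h.toLinearMap ∘ₗ a) := by
  rw [convDivPow, LinearMap.comp_smul, algHom_comp_ofConv_pow]; rfl

theorem convDivPow_add [CharZero F] [Coalgebra.IsCocomm F C] (n : ℕ) (a b : C →ₗ[F] A) :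
    convDivPow n (a + b) = ∑ p ∈ Finset.HasAntidiagonal.antidiagonal n,
      cup (LinearMap.mul F A) (convDivPow p.1 a) (convDivPow p.2 b) := by
  have h : ∀ p ∈ Finset.HasAntidiagonal.antidiagonal n,
      cup (LinearMap.mul F A) (convDivPow p.1 a) (convDivPow p.2 b) =
        ((n.factorial : F)⁻¹ • (n.choose p.1 • (toConv a ^ p.1 * toConv b ^ p.2))).ofConv := by
    intro p hp
    rw [Finset.HasAntidiagonal.mem_antidiagonal] at hp
    subst hp
    have e : cup (LinearMap.mul F A) (convDivPow p.1 a) (convDivPow p.2 b) =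
        (((p.1.factorial : F)⁻¹ • toConv a ^ p.1) * ((p.2.factorial : F)⁻¹ • toConv b ^ p.2)).ofConv :=
      rfl
    rw [e, smul_mul_smul_comm, ← Nat.cast_smul_eq_nsmul F, smul_smul]
    congr 2
    have h1 : ((p.1 + p.2).factorial : F) ≠ 0 := Nat.cast_ne_zero.mpr (Nat.factorial_ne_zero _)
    have h2 : (p.1.factorial : F) ≠ 0 := Nat.cast_ne_zero.mpr (Nat.factorial_ne_zero _)
    have h3 : (p.2.factorial : F) ≠ 0 := Nat.cast_ne_zero.mpr (Nat.factorial_ne_zero _)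
    have h4 : ((p.1 + p.2).choose p.1 : F) * p.1.factorial * p.2.factorial =
        (p.1 + p.2).factorial := by
      rw [Nat.choose_symm_add]
      exact_mod_cast Nat.add_choose_mul_factorial_mul_factorial p.1 p.2
    rw [← h4]
    have h5 : ((p.1 + p.2).choose p.1 : F) ≠ 0 := by
      intro h0; rw [h0] at h4; simp at h4; exact h1 h4.symm
    field_simp
  rw [Finset.sum_congr rfl h, convDivPow, toConv_add, (Commute.all _ _).add_pow']
  rw [← WithConv.ofConv_smul, Finset.smul_sum]
  exact map_sum (WithConv.linearEquiv F (C →ₗ[F] A)) _ _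

end DividedPowers

section Adjoint

open WithConv

variable {F : Type*} [Field F] {U X : Type*} [AddCommGroup U] [Module F U]
  [AddCommGroup X] [Module F X]

theorem vanishBelow_convDivPow {A : Type*} [CommRing A] [Algebra F A] {a : Sc F X →ₗ[F] A}
    (ha : VanishBelow 1 a) (n : ℕ) : VanishBelow n (convDivPow n a) := by
  refine VanishBelow.smul ?_ _
  induction n with
  | zero => exact .zero _
  | succ n ih => rw [pow_succ, ofConv_mul_eq_cup]; exact ih.cup _ ha

theorem cogen_comp_convDivPow (f : Sc F X →ₗ[F] U) (n : ℕ) :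
    cogen ∘ₗ convDivPow (n + 2) (SymmetricAlgebra.ι F U ∘ₗ f) = 0 := by
  have h0 : (Bialgebra.counitAlgHom F (Sc F U)).toLinearMap ∘ₗ
      (toConv (SymmetricAlgebra.ι F U ∘ₗ f) ^ (n + 1)).ofConv = 0 := by
    have : (Bialgebra.counitAlgHom F (Sc F U)).toLinearMap ∘ₗ SymmetricAlgebra.ι F U ∘ₗ f = 0 := by
      ext1 x; simp [SymmetricAlgebra.algebraMapInv_ι]
    rw [algHom_comp_ofConv_pow, this, toConv_zero, zero_pow n.succ_ne_zero, ofConv_zero]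
  have h1 : ∀ t, cogen (TensorProduct.lift (LinearMap.mul F (Sc F U))
      (TensorProduct.map (SymmetricAlgebra.ι F U ∘ₗ f)
        (toConv (SymmetricAlgebra.ι F U ∘ₗ f) ^ (n + 1)).ofConv t)) = 0 := by
    intro t
    induction t using TensorProduct.induction_on with
    | zero => simp
    | add x y hx hy => simp only [map_add, hx, hy, add_zero]
    | tmul x y =>
      have := congr($h0 y)
      simp only [LinearMap.comp_apply, AlgHom.toLinearMap_apply, Bialgebra.counitAlgHom_apply,
        LinearMap.zero_apply] at this
      rw [TensorProduct.map_tmul, TensorProduct.lift.tmul, LinearMap.mul_apply', cogen_mul, this,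
        LinearMap.comp_apply, SymmetricAlgebra.counit_ι, zero_smul, zero_smul, add_zero]
  ext1 x
  rw [convDivPow, LinearMap.comp_smul, pow_succ', ofConv_mul_eq_cup, LinearMap.smul_apply,
    LinearMap.comp_apply]
  exact (congrArg _ (h1 _)).trans (smul_zero _)

theorem vanishBelow_ι_comp {f : Sc F X →ₗ[F] U} (hf : f 1 = 0) :
    VanishBelow 1 (SymmetricAlgebra.ι F U ∘ₗ f) :=
  (vanishBelow_one_iff.mpr hf).comp _

/-- The convolution exponential `exp(f) = Σ fⁿ / n!`. -/
noncomputable def convExp (f : Sc F X →ₗ[F] U) (hf : f 1 = 0) : Sc F X →ₗ[F] Sc F U :=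
  pointwiseSum (fun n => convDivPow n (SymmetricAlgebra.ι F U ∘ₗ f))
    (VanishBelow.locallyFinite (vanishBelow_convDivPow (vanishBelow_ι_comp hf)))

/-- A linear map that annihilates all terms but one of the exponential series picks out that
term. -/
theorem comp_convExp_eq {W : Type*} [AddCommGroup W] [Module F W] {f : Sc F X →ₗ[F] U}
    (hf : f 1 = 0) (k : ℕ) (A : Sc F U →ₗ[F] W)
    (h : ∀ n, n ≠ k → A ∘ₗ convDivPow n (SymmetricAlgebra.ι F U ∘ₗ f) = 0) :
    A ∘ₗ convExp f hf = A ∘ₗ convDivPow k (SymmetricAlgebra.ι F U ∘ₗ f) := by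
  rw [convExp, comp_pointwiseSum (vanishBelow_convDivPow (vanishBelow_ι_comp hf))]
  ext1 x
  exact finsum_eq_single _ k fun n hn => congr($(h n hn) x)

theorem cogen_comp_convExp {f : Sc F X →ₗ[F] U} (hf : f 1 = 0) : cogen ∘ₗ convExp f hf = f := by
  rw [comp_convExp_eq hf 1, convDivPow_one]
  · ext1 x; simp [cogen_ι]
  · rintro (_ | _ | n) hn
    · rw [convDivPow_zero]; ext1 x; simp [cogen_algebraMap]
    · exact absurd rfl hn
    · exact cogen_comp_convDivPow f n

theorem counit_comp_convExp {f : Sc F X →ₗ[F] U} (hf : f 1 = 0) :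
    Coalgebra.counit ∘ₗ convExp f hf = Coalgebra.counit (R := F) (A := Sc F X) := by
  rw [comp_convExp_eq hf 0, convDivPow_zero]
  · ext1 x; simp
  · intro n hn
    have h := algHom_comp_convDivPow (Bialgebra.counitAlgHom F (Sc F U)) n
      (SymmetricAlgebra.ι F U ∘ₗ f)
    have h0 : (Bialgebra.counitAlgHom F (Sc F U)).toLinearMap ∘ₗ SymmetricAlgebra.ι F U ∘ₗ f =
        0 := by
      ext1 x; simp [SymmetricAlgebra.algebraMapInv_ι]
    rw [h0] at h
    refine Eq.trans h ?_
    rw [convDivPow, toConv_zero, zero_pow hn, ofConv_zero, smul_zero]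

theorem convExp_one {f : Sc F X →ₗ[F] U} (hf : f 1 = 0) : convExp f hf 1 = 1 := by
  rw [convExp, pointwiseSum_eq_sum_range (vanishBelow_convDivPow (vanishBelow_ι_comp hf))
    (one_mem_Fil 0), zero_add, Finset.sum_range_one, convDivPow_zero]
  simp

theorem cup_mk {C V : Type*} [AddCommGroup C] [Module F C] [Coalgebra F C] [AddCommGroup V]
    [Module F V] (a b : C →ₗ[F] V) :
    cup (TensorProduct.mk F V V) a b = TensorProduct.map a b ∘ₗ Coalgebra.comul := by
  rw [cup, TensorProduct.lift_mk, LinearMap.id_comp]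

theorem comul_comp_convDivPow [CharZero F] (f : Sc F X →ₗ[F] U) (n : ℕ) :
    Coalgebra.comul (R := F) ∘ₗ convDivPow n (SymmetricAlgebra.ι F U ∘ₗ f) =
      ∑ p ∈ Finset.HasAntidiagonal.antidiagonal n, cup (TensorProduct.mk F (Sc F U) (Sc F U))
        (convDivPow p.1 (SymmetricAlgebra.ι F U ∘ₗ f))
        (convDivPow p.2 (SymmetricAlgebra.ι F U ∘ₗ f)) := by
  let l : Sc F U →ₐ[F] Sc F U ⊗[F] Sc F U := Algebra.TensorProduct.includeLeft
  let r : Sc F U →ₐ[F] Sc F U ⊗[F] Sc F U := Algebra.TensorProduct.includeRight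
  -- the members of `U` are primitive
  have h1 : (Bialgebra.comulAlgHom F (Sc F U)).toLinearMap ∘ₗ SymmetricAlgebra.ι F U ∘ₗ f =
      l.toLinearMap ∘ₗ (SymmetricAlgebra.ι F U ∘ₗ f) +
        r.toLinearMap ∘ₗ (SymmetricAlgebra.ι F U ∘ₗ f) := by
    ext1 x; simp [l, r]
  refine (algHom_comp_convDivPow (Bialgebra.comulAlgHom F (Sc F U)) n _).trans ?_
  rw [h1, convDivPow_add]
  refine Finset.sum_congr rfl fun p _ => ?_
  rw [← algHom_comp_convDivPow, ← algHom_comp_convDivPow]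
  simp only [cup, ← LinearMap.comp_assoc]
  congr 1
  ext x y
  simp [l, r]

theorem comul_comp_convExp [CharZero F] {f : Sc F X →ₗ[F] U} (hf : f 1 = 0) :
    TensorProduct.map (convExp f hf) (convExp f hf) ∘ₗ Coalgebra.comul =
      Coalgebra.comul ∘ₗ convExp f hf := by
  have hv := vanishBelow_convDivPow (vanishBelow_ι_comp hf)
  rw [← cup_mk, convExp, cup_pointwiseSum _ hv hv, comp_pointwiseSum hv]
  simp only [comul_comp_convDivPow]

/-- Cofreeness of `Sᶜ[U]`, existence: the adjoint of a linear map `f : Sᶜ[X] → U` with `f(1) = 0` is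
its convolution exponential. -/
theorem exists_isAdjoint [CharZero F] (f : Sc F X →ₗ[F] U) (hf : f 1 = 0) :
    ∃ φ : Sc F X →ₗc[F] Sc F U, IsAdjoint f φ :=
  ⟨{ convExp f hf with
      counit_comp := counit_comp_convExp hf
      map_comp_comul := comul_comp_convExp hf },
    convExp_one hf, fun x => congr($(cogen_comp_convExp hf) x)⟩

end Adjoint

/-! ### Zero loci, subcoalgebras, and formal automorphisms -/

section Comodule

variable {F : Type*} [Field F] {C D W W' : Type*} [AddCommGroup C] [Module F C] [Coalgebra F C]
  [AddCommGroup D] [Module F D] [Coalgebra F D]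
  [AddCommGroup W] [Module F W] [AddCommGroup W'] [Module F W']

theorem comoduleMap_comp_left (A : W →ₗ[F] W') (y : C →ₗ[F] W) :
    comoduleMap (A ∘ₗ y) = A.lTensor C ∘ₗ comoduleMap y := by
  rw [comoduleMap, LinearMap.lTensor_comp, LinearMap.comp_assoc]; rfl

theorem comoduleMap_comp_coalgHom (y : C →ₗ[F] W) (φ : D →ₗc[F] C) :
    comoduleMap y ∘ₗ φ.toLinearMap =
      φ.toLinearMap.rTensor W ∘ₗ comoduleMap (y ∘ₗ φ.toLinearMap) := by
  rw [comoduleMap, comoduleMap, LinearMap.comp_assoc, ← φ.map_comp_comul, ← LinearMap.comp_assoc,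
    ← LinearMap.comp_assoc, LinearMap.lTensor_comp_map, LinearMap.rTensor_comp_lTensor]

namespace Subcoalgebra

/-- The inclusion of a subcoalgebra, as a morphism of coalgebras. -/
noncomputable def incl (E : Subcoalgebra F C) : E.toSubmodule →ₗc[F] C where
  __ := E.toSubmodule.subtype
  counit_comp := rfl
  map_comp_comul := LinearMap.ext E.map_comulMap

/-- A morphism of coalgebras with values in a subcoalgebra, with its codomain restricted. -/
noncomputable def codRestrict (E : Subcoalgebra F C) (φ : D →ₗc[F] C)
    (h : ∀ x, φ x ∈ E.toSubmodule) : D →ₗc[F] E.toSubmodule where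
  __ := φ.toLinearMap.codRestrict E.toSubmodule h
  counit_comp := φ.counit_comp
  map_comp_comul := by
    refine (LinearMap.cancel_left (map_subtype_injective E.toSubmodule)).mp ?_
    rw [← LinearMap.comp_assoc, ← TensorProduct.map_comp, ← LinearMap.comp_assoc]
    have h1 : TensorProduct.map E.toSubmodule.subtype E.toSubmodule.subtype ∘ₗ
        Coalgebra.comul (R := F) (A := E.toSubmodule) =
          Coalgebra.comul ∘ₗ E.toSubmodule.subtype := LinearMap.ext E.map_comulMap
    rw [h1]
    exact φ.map_comp_comul

end Subcoalgebra

variable [Coalgebra.IsCocomm F C]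

theorem mem_zeroLocus {y : C →ₗ[F] W} {x : C} :
    x ∈ (zeroLocus y).toSubmodule ↔ comoduleMap y x = 0 := Iff.rfl

theorem apply_eq_zero_of_mem_zeroLocus {y : C →ₗ[F] W} {x : C}
    (hx : x ∈ (zeroLocus y).toSubmodule) : y x = 0 := by
  have h : (Coalgebra.counit (R := F) (A := C)).rTensor W (comoduleMap y x) = 1 ⊗ₜ y x := by
    rw [comoduleMap, LinearMap.comp_apply, ← LinearMap.comp_apply, LinearMap.rTensor_comp_lTensor,
      ← LinearMap.lTensor_comp_rTensor, LinearMap.comp_apply, Coalgebra.rTensor_counit_comul]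
    simp
  rw [mem_zeroLocus.mp hx, map_zero] at h
  simpa using congr(TensorProduct.lid F W $h).symm

theorem zeroLocus_le_comp (A : W →ₗ[F] W') (y : C →ₗ[F] W) :
    (zeroLocus y).toSubmodule ≤ (zeroLocus (A ∘ₗ y)).toSubmodule := by
  intro x hx
  rw [mem_zeroLocus, comoduleMap_comp_left, LinearMap.comp_apply, mem_zeroLocus.mp hx, map_zero]

/-- If `y ∘ φ = A ∘ y'` with `φ` and `A` injective, then the zero locus of `y'` is the preimage
under `φ` of that of `y`. -/
theorem mem_zeroLocus_coalgHom_iff [Coalgebra.IsCocomm F D] {y : C →ₗ[F] W} {y' : D →ₗ[F] W'}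
    {φ : D →ₗc[F] C} (hφ : Function.Injective φ) {A : W' →ₗ[F] W} (hA : Function.Injective A)
    (h : y ∘ₗ φ.toLinearMap = A ∘ₗ y') (x : D) :
    φ x ∈ (zeroLocus y).toSubmodule ↔ x ∈ (zeroLocus y').toSubmodule := by
  have h1 := congr($(comoduleMap_comp_coalgHom y φ) x)
  rw [h, comoduleMap_comp_left] at h1
  simp only [LinearMap.comp_apply] at h1
  rw [mem_zeroLocus, mem_zeroLocus]
  refine Eq.congr_left h1 |>.trans ?_
  rw [map_eq_zero_iff _ (Module.Flat.rTensor_preserves_injective_linearMap _ hφ),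
    map_eq_zero_iff _ (Module.Flat.lTensor_preserves_injective_linearMap _ hA)]

theorem coalgHom_mem_zeroLocus {y : C →ₗ[F] W} {φ : D →ₗc[F] C} {x : D}
    (h : comoduleMap (y ∘ₗ φ.toLinearMap) x = 0) : φ x ∈ (zeroLocus y).toSubmodule := by
  have h1 := congr($(comoduleMap_comp_coalgHom y φ) x)
  rw [LinearMap.comp_apply, LinearMap.comp_apply, h, map_zero] at h1
  exact h1

end Comodule

section Sc

variable {F : Type*} [Field F] {U W : Type*} [AddCommGroup U] [Module F U]
  [AddCommGroup W] [Module F W]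

theorem cogen_map (f : U →ₗ[F] W) (x : Sc F U) : cogen (Sc.map f x) = f (cogen x) := by
  have hc : ∀ x, Coalgebra.counit (R := F) (Sc.map f x) = Coalgebra.counit (R := F) x :=
    fun x => CoalgHomClass.counit_comp_apply (Sc.map f) x
  induction x using SymmetricAlgebra.induction with
  | algebraMap r =>
    have : Sc.map f (algebraMap F (Sc F U) r) = algebraMap F (Sc F W) r :=
      AlgHomClass.commutes (Sc.map f) r
    rw [this, cogen_algebraMap, cogen_algebraMap, map_zero]
  | ι u =>
    have : Sc.map f (SymmetricAlgebra.ι F U u) = SymmetricAlgebra.ι F W (f u) :=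
      SymmetricAlgebra.lift_ι_apply (f := SymmetricAlgebra.ι F W ∘ₗ f) u
    rw [this, cogen_ι, cogen_ι]
  | mul a b ha hb =>
    rw [map_mul, cogen_mul, cogen_mul, ha, hb, hc, hc, map_add, map_smul, map_smul]
  | add a b ha hb => simp only [map_add, ha, hb]

/-- If `f` is the identity on `ker P`, then `Sᶜ[f]` is the identity on `zeroLocus (P ∘ cogen)`, the
coordinate coalgebra `Sᶜ[ker P]` of the linear subspace `ker P`. -/
theorem map_eq_self_of_mem_zeroLocus [CharZero F] {P : U →ₗ[F] W} {f : U →ₗ[F] U}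
    (h : ∀ u, P u = 0 → f u = u) {z : Sc F U} (hz : z ∈ (zeroLocus (P ∘ₗ cogen)).toSubmodule) :
    Sc.map f z = z := by
  have e : ((Sc.map f).toCoalgHom.comp (zeroLocus (P ∘ₗ cogen)).incl) =
      (zeroLocus (P ∘ₗ cogen)).incl := by
    refine coalgHom_ext fun x => ?_
    exact (cogen_map f _).trans (h _ (apply_eq_zero_of_mem_zeroLocus (y := P ∘ₗ cogen) x.2))
  exact congr($e ⟨z, hz⟩)

/-- A formal endomorphism of `U` with linear part the identity is the identity on the associated
graded of the coaugmentation filtration. -/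
theorem weight_comp_sub_weight_vanishBelow [CharZero F] {Φ : Sc F U →ₗc[F] Sc F U}
    (h : VanishBelow 2 (cogen ∘ₗ Φ.toLinearMap - cogen)) (n : ℕ) :
    VanishBelow (n + 1) (weight n ∘ₗ Φ.toLinearMap - weight n) := by
  induction n with
  | zero =>
    have : weight 0 ∘ₗ Φ.toLinearMap - weight 0 = 0 := by
      ext1 x; simp [weight_zero]
    rw [this]
    exact fun _ _ _ _ => rfl
  | succ n ih =>
    have hn : ((n + 1 : ℕ) : F) ≠ 0 := Nat.cast_ne_zero.mpr n.succ_ne_zero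
    set B := LinearMap.mul F (Sc F U)
    set i := SymmetricAlgebra.ι F U
    have e : ((n + 1 : ℕ) : F) • (weight (n + 1) ∘ₗ Φ.toLinearMap - weight (n + 1)) =
        cup B (i ∘ₗ (cogen ∘ₗ Φ.toLinearMap - cogen)) (weight n ∘ₗ Φ.toLinearMap) +
          cup B (i ∘ₗ cogen) (weight n ∘ₗ Φ.toLinearMap - weight n) := by
      rw [smul_sub, ← LinearMap.smul_comp, smul_weight_succ, cup_comp, LinearMap.comp_sub,
        cup_sub_left, cup_sub_right, LinearMap.comp_assoc]
      abel
    have e' : weight (n + 1) ∘ₗ Φ.toLinearMap - weight (n + 1) =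
        ((n + 1 : ℕ) : F)⁻¹ • (((n + 1 : ℕ) : F) •
          (weight (n + 1) ∘ₗ Φ.toLinearMap - weight (n + 1))) := by
      rw [smul_smul, inv_mul_cancel₀ hn, one_smul]
    have hw : VanishBelow n (weight n ∘ₗ Φ.toLinearMap) := by
      have := (ih.mono n.le_succ).add (vanishBelow_weight (F := F) (U := U) n)
      rwa [sub_add_cancel] at this
    rw [e', e]
    refine VanishBelow.smul (VanishBelow.add ?_ ?_) _
    · exact ((h.comp i).cup B hw).mono (by omega)
    · exact ((vanishBelow_cogen.comp i).cup B ih).mono (by omega)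

/-- A formal endomorphism of `U` with linear part the identity is injective. -/
theorem injective_of_vanishBelow_two [CharZero F] {Φ : Sc F U →ₗc[F] Sc F U}
    (h : VanishBelow 2 (cogen ∘ₗ Φ.toLinearMap - cogen)) : Function.Injective Φ := by
  rw [injective_iff_map_eq_zero]
  have key : ∀ N, ∀ x ∈ Fil F U N, Φ x = 0 → x = 0 := by
    intro N
    induction N with
    | zero =>
      intro x hx hΦ
      have h0 := weight_comp_sub_weight_vanishBelow h 0 0 Nat.one_pos x hx
      have hx0 : weight 0 x = 0 := by simpa [hΦ] using h0
      refine (eq_sum_weight (N := 0) fun n _ => ?_).trans (Finset.sum_range_zero _)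
      rcases n.eq_zero_or_pos with rfl | hn
      · exact hx0
      · exact vanishBelow_weight n 0 hn x hx
    | succ N ih =>
      intro x hx hΦ
      have h0 := weight_comp_sub_weight_vanishBelow h (N + 1) (N + 1) (Nat.lt_succ_self _) x hx
      have hx0 : weight (N + 1) x = 0 := by simpa [hΦ] using h0
      refine ih x ?_ hΦ
      rw [eq_sum_weight (N := N + 1) (x := x) fun n hn => ?_]
      · refine sum_mem fun n hn => ?_
        exact Fil_mono (Nat.le_of_lt_succ (Finset.mem_range.mp hn)) (weight_mem_Fil n x)
      · rcases hn.eq_or_lt with rfl | hn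
        · exact hx0
        · exact vanishBelow_weight n (N + 1) hn x hx
  intro x hx
  obtain ⟨N, hN⟩ := exists_mem_Fil x
  exact key N x hN hx

end Sc

/-! ### The Kuranishi coalgebra -/

section Kuranishi

variable {F : Type*} [Field F] {g : ℤ → Type*} [∀ n, AddCommGroup (g n)] [∀ n, Module F (g n)]

theorem H0_toSubmodule {U W : Type*} [AddCommGroup U] [Module F U] [AddCommGroup W] [Module F W]
    (f : Sc F U →ₗ[F] W) : (H0 f).toSubmodule = (zeroLocus f).toSubmodule :=
  ker_coder_degZero f

namespace Contraction

variable {L : DGLie F g} (c : Contraction L)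

theorem h_d (hL : ∀ n : ℤ, n ≠ -1 → n ≠ -2 → Subsingleton (g n)) (x : g (-1)) :
    c.h (-2) (-1) rfl (L.d (-1) (-2) rfl x) = x - c.nabla (-1) (c.pi (-1) x) := by
  have h := c.homotopy (-1) 0 (-2) rfl rfl x
  have h0 : c.h (-1) 0 rfl x = 0 := by
    have := hL 0 (by decide) (by decide)
    exact Subsingleton.elim _ _
  rwa [h0, map_zero, zero_add] at h

theorem d_h (hL : ∀ n : ℤ, n ≠ -1 → n ≠ -2 → Subsingleton (g n)) (y : g (-2)) :
    L.d (-1) (-2) rfl (c.h (-2) (-1) rfl y) = y - c.nabla (-2) (c.pi (-2) y) := by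
  have h := c.homotopy (-2) (-1) (-3) rfl rfl y
  have h0 : L.d (-2) (-3) rfl y = 0 := by
    have := hL (-3) (by decide) (by decide)
    exact Subsingleton.elim _ _
  rwa [h0, map_zero, add_zero] at h

theorem dV_hV_dV (hL : ∀ n : ℤ, n ≠ -1 → n ≠ -2 → Subsingleton (g n)) :
    L.dV ∘ₗ c.hV ∘ₗ L.dV = L.dV := by
  ext1 x
  have h : L.d (-1) (-2) rfl (c.h (-2) (-1) rfl (L.d (-1) (-2) rfl x)) =
      L.d (-1) (-2) rfl x := by
    rw [c.d_h hL, c.pi_d, map_zero, sub_zero]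
  simp only [DGLie.dV, hV, LinearMap.comp_apply, LinearMap.neg_apply, map_neg, neg_neg]
  rw [h]

theorem nabla_injective (n : ℤ) : Function.Injective (c.nabla n) :=
  Function.LeftInverse.injective (c.pi_nabla n)

theorem bracketSum_eq_sum_antidiagonal (n : ℕ) :
    c.bracketSum n = ∑ p ∈ Finset.HasAntidiagonal.antidiagonal n,
      cup L.bracket (c.tauL p.1) (c.tauL p.2) := by
  have h0 : c.tauL 0 = 0 := by rw [tauL]
  have hl : ∀ a : Sc F L.v₀ →ₗ[F] g (-1), cup L.bracket 0 a = 0 := fun a => by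
    rw [← sub_self (0 : Sc F L.v₀ →ₗ[F] g (-1)), cup_sub_left, sub_self]
  have hr : ∀ a : Sc F L.v₀ →ₗ[F] g (-1), cup L.bracket a 0 = 0 := fun a => by
    rw [← sub_self (0 : Sc F L.v₀ →ₗ[F] g (-1)), cup_sub_right, sub_self]
  rw [Finset.Nat.sum_antidiagonal_eq_sum_range_succ
    (fun i j => cup L.bracket (c.tauL i) (c.tauL j))]
  rcases n with _ | _ | n
  · simp [bracketSum, h0, hl]
  · simp [bracketSum, h0, hl, hr, Finset.sum_range_succ]
  · rw [bracketSum, Finset.sum_range_succ, Finset.sum_range_succ', Finset.sum_range, h0, hl,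
      Nat.sub_self, h0, hr, add_zero, add_zero]
    refine Finset.sum_congr rfl fun i _ => ?_
    rw [show n + 1 + 1 - ((i : ℕ) + 1) = n + 1 - i by omega]

theorem cup_tau_tau : cup L.bracket c.tau c.tau =
    pointwiseSum c.bracketSum (VanishBelow.locallyFinite c.vanishBelow_bracketSum) := by
  rw [tau, cup_pointwiseSum L.bracket c.vanishBelow_tauL c.vanishBelow_tauL]
  simp only [← bracketSum_eq_sum_antidiagonal]

theorem tau_one : c.tau 1 = 0 := by
  rw [tau, pointwiseSum_eq_sum_range c.vanishBelow_tauL (one_mem_Fil 0), zero_add,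
    Finset.sum_range_one, tauL]
  rfl

/-- The twisting cochain solves the fixed point equation `τ = ∇ s⁻¹ + ½ h [τ, τ]`. -/
theorem tau_eq : c.tau = c.nabla (-1) ∘ₗ cogen +
    (2⁻¹ : F) • (c.h (-2) (-1) rfl ∘ₗ cup L.bracket c.tau c.tau) := by
  rw [cup_tau_tau, comp_pointwiseSum c.vanishBelow_bracketSum]
  have hn : ∀ n, c.tauL n = (if n = 1 then c.nabla (-1) ∘ₗ cogen else 0) +
      (2⁻¹ : F) • (c.h (-2) (-1) rfl ∘ₗ c.bracketSum n) := by
    rintro (_ | _ | n)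
    · simp [tauL, bracketSum]
    · simp [tauL, bracketSum]
    · rw [tauL, bracketSum, if_neg (by omega), zero_add]
  ext1 x
  obtain ⟨m, hm⟩ := exists_mem_Fil x
  -- the partial sums have to include the index `1`
  have hm' : x ∈ Fil F L.v₀ (m + 1) := Fil_mono m.le_succ hm
  rw [LinearMap.add_apply, LinearMap.smul_apply, tau,
    pointwiseSum_eq_sum_range c.vanishBelow_tauL hm',
    pointwiseSum_eq_sum_range (fun n => (c.vanishBelow_bracketSum n).comp _) hm',
    Finset.smul_sum, ← LinearMap.sum_apply, Finset.sum_congr rfl fun n _ => hn n,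
    Finset.sum_add_distrib, Finset.sum_ite_eq', if_pos (Finset.mem_range.mpr (by omega)),
    LinearMap.add_apply, LinearMap.sum_apply]
  rfl

theorem corestriction_eq : c.corestriction =
    (2⁻¹ : F) • (c.pi (-2) ∘ₗ cup L.bracket c.tau c.tau) := by
  rw [cup_tau_tau, ← LinearMap.smul_comp, comp_pointwiseSum c.vanishBelow_bracketSum]
  rfl

/-- The formal map of `x ↦ x - h q(x)`, where `h` is the homotopy of the differential graded Lie
algebra (`hV` is `-h`).  Its adjoint straightens the variety `x₂ + h q_B(x) = 0` to the linear
subspace `h d x = 0`. -/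
noncomputable def straightening : Sc F L.V₀ →ₗ[F] L.V₀ := cogen + c.hV ∘ₗ L.Q

theorem vanishBelow_Q : VanishBelow 2 L.Q :=
  (vanishBelow_cogen.cup L.bracket vanishBelow_cogen).smul _

theorem straightening_one : c.straightening 1 = 0 := by
  have h2 : L.Q 1 = 0 := vanishBelow_Q 0 (by omega) 1 (one_mem_Fil 0)
  rw [straightening, LinearMap.add_apply, cogen_one, LinearMap.comp_apply, h2, map_zero, zero_add]

theorem formalEqM_eq_straightening :
    c.formalEqM = (c.hV ∘ₗ L.dV) ∘ₗ c.straightening := by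
  rw [formalEqM, straightening, LinearMap.comp_add]
  rfl

theorem formalEqM_eq_formalJB : c.formalEqM = c.hV ∘ₗ c.formalJB := by
  rw [formalEqM, formalJB, LinearMap.comp_add]

theorem formalJB_eq_formalEqM (hL : ∀ n : ℤ, n ≠ -1 → n ≠ -2 → Subsingleton (g n)) :
    c.formalJB = L.dV ∘ₗ c.formalEqM := by
  rw [formalEqM_eq_straightening, ← LinearMap.comp_assoc, c.dV_hV_dV hL, formalJB, straightening,
    LinearMap.comp_add]
  rfl

theorem formalEqM_eq_formalJ (hL : ∀ n : ℤ, n ≠ -1 → n ≠ -2 → Subsingleton (g n)) :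
    c.formalEqM = (c.hV ∘ₗ L.dV ∘ₗ c.hV) ∘ₗ L.formalJ := by
  have h : (c.hV ∘ₗ L.dV ∘ₗ c.hV) ∘ₗ L.dV = c.hV ∘ₗ L.dV := by
    conv_rhs => rw [← c.dV_hV_dV hL]
    rfl
  rw [DGLie.formalJ, LinearMap.comp_add, ← LinearMap.comp_assoc, h]
  rfl

section Adjoint

variable {c} {φ : Sc F L.v₀ →ₗc[F] Sc F L.V₀} (hφ : IsAdjoint c.tau φ)
include hφ

theorem cogen_comp_of_isAdjoint : cogen ∘ₗ φ.toLinearMap = c.tau := LinearMap.ext hφ.2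

theorem Q_comp_of_isAdjoint :
    L.Q ∘ₗ φ.toLinearMap = (2⁻¹ : F) • cup L.bracket c.tau c.tau := by
  rw [DGLie.Q, LinearMap.smul_comp, cup_comp, cogen_comp_of_isAdjoint hφ]

theorem straightening_comp_of_isAdjoint :
    c.straightening ∘ₗ φ.toLinearMap = c.nabla (-1) ∘ₗ cogen := by
  rw [straightening, LinearMap.add_comp, LinearMap.comp_assoc, Q_comp_of_isAdjoint hφ,
    cogen_comp_of_isAdjoint hφ, LinearMap.comp_smul]
  nth_rewrite 1 [c.tau_eq]
  rw [hV, LinearMap.neg_comp, smul_neg, add_neg_cancel_right]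

theorem formalJ_comp_of_isAdjoint (hL : ∀ n : ℤ, n ≠ -1 → n ≠ -2 → Subsingleton (g n)) :
    L.formalJ ∘ₗ φ.toLinearMap = c.nabla (-2) ∘ₗ c.corestriction := by
  rw [DGLie.formalJ, LinearMap.add_comp, LinearMap.comp_assoc, Q_comp_of_isAdjoint hφ,
    cogen_comp_of_isAdjoint hφ, corestriction_eq]
  nth_rewrite 1 [c.tau_eq]
  ext1 x
  simp only [DGLie.dV, LinearMap.add_apply, LinearMap.comp_apply, LinearMap.neg_apply, map_add,
    LinearMap.smul_apply, map_smul, c.d_nabla, c.d_h hL]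
  module

theorem mem_coordM_of_isAdjoint (x : Sc F L.v₀) : φ x ∈ c.coordM.toSubmodule := by
  refine coalgHom_mem_zeroLocus ?_
  have h : c.formalEqM ∘ₗ φ.toLinearMap = 0 := by
    rw [formalEqM_eq_straightening, LinearMap.comp_assoc, straightening_comp_of_isAdjoint hφ]
    ext1 x
    simp [DGLie.dV, c.d_nabla]
  rw [h, comoduleMap, LinearMap.lTensor_zero, LinearMap.zero_comp, LinearMap.zero_apply]

variable [CharZero F]

theorem map_pi_of_isAdjoint (x : Sc F L.v₀) : Sc.map (c.pi (-1)) (φ x) = x := by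
  have e : (Sc.map (c.pi (-1))).toCoalgHom.comp φ = CoalgHom.id F _ := by
    refine coalgHom_ext fun x => ?_
    refine (cogen_map _ _).trans ?_
    refine (congrArg _ (hφ.2 x)).trans ?_
    rw [c.tau_eq]
    simp [c.pi_nabla, c.pi_h]
  exact congr($e x)

theorem of_isAdjoint_map_pi (hL : ∀ n : ℤ, n ≠ -1 → n ≠ -2 → Subsingleton (g n)) {y : Sc F L.V₀}
    (hy : y ∈ c.coordM.toSubmodule) : φ (Sc.map (c.pi (-1)) y) = y := by
  obtain ⟨Θ, hΘ⟩ := exists_isAdjoint c.straightening c.straightening_one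
  have hΘ' : cogen ∘ₗ Θ.toLinearMap = c.straightening := LinearMap.ext hΘ.2
  have hinj : Function.Injective Θ := by
    refine injective_of_vanishBelow_two ?_
    rw [hΘ', straightening, add_sub_cancel_left]
    exact vanishBelow_Q.comp _
  -- `Θ` carries the image of `φ` to `Sᶜ[∇ v₀]` and preserves the projection to `Sᶜ[v₀]`
  have h1 : Θ.comp φ = (Sc.map (c.nabla (-1))).toCoalgHom := by
    refine coalgHom_ext fun x => ?_
    refine (hΘ.2 _).trans (Eq.trans ?_ (cogen_map _ x).symm)
    exact congr($(straightening_comp_of_isAdjoint hφ) x)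
  have h2 : (Sc.map (c.pi (-1))).toCoalgHom.comp Θ = (Sc.map (c.pi (-1))).toCoalgHom := by
    refine coalgHom_ext fun x => ?_
    refine (cogen_map _ _).trans (Eq.trans ?_ (cogen_map _ x).symm)
    refine (congrArg _ (hΘ.2 x)).trans ?_
    simp [straightening, hV, c.pi_h]
  have h3 : (Sc.map (c.nabla (-1))).toCoalgHom.comp (Sc.map (c.pi (-1))).toCoalgHom =
      (Sc.map (c.nabla (-1) ∘ₗ c.pi (-1))).toCoalgHom := by
    refine coalgHom_ext fun x => ?_
    refine (cogen_map _ _).trans (Eq.trans ?_ (cogen_map _ x).symm)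
    exact congrArg _ (cogen_map _ x)
  have hz : Θ y ∈ (zeroLocus ((c.hV ∘ₗ L.dV) ∘ₗ cogen)).toSubmodule := by
    refine coalgHom_mem_zeroLocus ?_
    rw [LinearMap.comp_assoc, hΘ', ← formalEqM_eq_straightening]
    exact hy
  refine hinj ?_
  calc Θ (φ (Sc.map (c.pi (-1)) y))
      = Sc.map (c.nabla (-1)) (Sc.map (c.pi (-1)) y) := congr($h1 _)
    _ = Sc.map (c.nabla (-1)) (Sc.map (c.pi (-1)) (Θ y)) := congrArg _ congr($h2 y).symm
    _ = Sc.map (c.nabla (-1) ∘ₗ c.pi (-1)) (Θ y) := congr($h3 _)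
    _ = Θ y := map_eq_self_of_mem_zeroLocus (fun u hu => ?_) hz
  simp only [hV, DGLie.dV, LinearMap.comp_apply, LinearMap.neg_apply, map_neg, neg_neg,
    c.h_d hL] at hu
  exact (sub_eq_zero.mp hu).symm

end Adjoint

end Contraction

end Kuranishi
end FormalKuranishi

theorem theorem6p7p2 {F : Type*} [Field F] [CharZero F] {g : ℤ → Type*}
    [∀ n, AddCommGroup (g n)] [∀ n, Module F (g n)] (L : DGLie F g)
    (hL : ∀ n : ℤ, n ≠ -1 → n ≠ -2 → Subsingleton (g n)) (c : Contraction L) :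
    -- the coordinate coalgebras are the degree zero homology coalgebras
    (H0 c.formalJB).toSubmodule = c.coordM.toSubmodule ∧
    (H0 L.formalJ).toSubmodule = L.coordV.toSubmodule ∧
    L.coordV.toSubmodule ≤ c.coordM.toSubmodule ∧
    -- the twisting cochain has a unique adjoint
    (∃! φ : Sc F L.v₀ →ₗc[F] Sc F L.V₀, IsAdjoint c.tau φ) ∧
    ∀ φ : Sc F L.v₀ →ₗc[F] Sc F L.V₀, IsAdjoint c.tau φ →
      -- the adjoint and the projection are mutually inverse isomorphisms of coalgebras
      (∃ e : Sc F L.v₀ ≃ₗc[F] c.coordM.toSubmodule,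
        (∀ x, (e x : Sc F L.V₀) = φ x) ∧
        ∀ y : c.coordM.toSubmodule, e.symm y = Sc.map (c.pi (-1)) (y : Sc F L.V₀)) ∧
      -- the adjoint restricts to an isomorphism of coalgebras from the Kuranishi coalgebra
      ∃ e : c.kuranishi.toSubmodule ≃ₗc[F] L.coordV.toSubmodule,
        ∀ x : c.kuranishi.toSubmodule, (e x : Sc F L.V₀) = φ (x : Sc F L.v₀) := by
  have hVM : L.coordV.toSubmodule ≤ c.coordM.toSubmodule := by
    rw [Contraction.coordM, c.formalEqM_eq_formalJ hL]
    exact zeroLocus_le_comp _ _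
  refine ⟨?_, H0_toSubmodule _, hVM, ?_, fun φ hφ => ⟨?_, ?_⟩⟩
  · rw [H0_toSubmodule]
    refine le_antisymm ?_ ?_
    · rw [Contraction.coordM, c.formalEqM_eq_formalJB]
      exact zeroLocus_le_comp _ _
    · rw [c.formalJB_eq_formalEqM hL]
      exact zeroLocus_le_comp _ _
  · obtain ⟨φ, hφ⟩ := exists_isAdjoint c.tau c.tau_one
    exact ⟨φ, hφ, fun ψ hψ => coalgHom_ext fun x => (hψ.2 x).trans (hφ.2 x).symm⟩
  · refine ⟨CoalgEquiv.ofCoalgHom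
      (c.coordM.codRestrict φ (Contraction.mem_coordM_of_isAdjoint hφ))
      ((Sc.map (c.pi (-1))).toCoalgHom.comp c.coordM.incl) ?_ ?_, fun x => rfl, fun y => rfl⟩
    · ext y
      exact Contraction.of_isAdjoint_map_pi hφ hL y.2
    · ext x
      exact Contraction.map_pi_of_isAdjoint hφ x
  · have hinj : Function.Injective φ :=
      Function.LeftInverse.injective (Contraction.map_pi_of_isAdjoint hφ)
    have hiff : ∀ x, φ x ∈ L.coordV.toSubmodule ↔ x ∈ c.kuranishi.toSubmodule := by
      intro x
      rw [Contraction.kuranishi, H0_toSubmodule]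
      exact mem_zeroLocus_coalgHom_iff hinj (c.nabla_injective (-2))
        (Contraction.formalJ_comp_of_isAdjoint hφ hL) x
    refine ⟨CoalgEquiv.ofBijective (f := L.coordV.codRestrict (φ.comp c.kuranishi.incl)
      fun x => (hiff x).mpr x.2) ⟨fun x y h => ?_, fun y => ?_⟩, fun x => rfl⟩
    · exact Subtype.ext (hinj congr(($h : Sc F L.V₀)))
    · have hy := Contraction.of_isAdjoint_map_pi hφ hL (hVM y.2)
      exact ⟨⟨_, (hiff _).mp (hy.symm ▸ y.2)⟩, Subtype.ext hy⟩
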